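/- Let $l_1,\ldots,l_6$ be real linear forms in three variables defining six lines $V(l_1),\ldots,V(l_6)$ in ${\bf P}^2$, no three of which have a point in common. Take an affine chart ${\mathbb R}^2 \subset {\bf P}^2({\mathbb R})$, ${\mathbb C}^2\subset {\bf P}^2({\mathbb C})$, given by real linear coordinates, that meets each of the six lines. Let $A_{i1}x + A_{i2}y + A_{i3} = 0$ be the equation of $V(l_i)$ in this chart, put $$E := \bigcup_{i=1}^6 \operatorname{span}(A_{i2}, -A_{i1}) \subset {\mathbb R}^2,$$ and let $b \in {\mathbb R}^2\setminus E$. Let $\gamma\colon {\mathbb R}/{\mathbb Z} \to {\bf P}^2({\mathbb R})$ be a continuous closed curve that meets $V(l_1\cdots l_6)$ only in double points of this union of lines and that, at each parameter $t$ for which $\gamma(t)$ is a double point $V(l_i)\cap V(l_j)$, crosses both $V(l_i)$ and $V(l_j)$ (i.e. local affine equations of both lines change sign along $\gamma$ at $t$, so that $\gamma$ passes from one of the four local sectors to the opposite one). For example, $\gamma$ may be a deformed line through three double points, or it may encircle a triangle, a quadrangle or a pentagon through its vertices. Assume that $\gamma(t)$, for every $t$, either lies in the affine chart or is the point at infinity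 in direction $b$. (There is no point of the second kind when $\gamma$ is contained in the chart.) Realise $S^2$ as the suspension of the circle, i.e. as the quotient of ${\mathbb R}/{\mathbb Z}\times[-\infty,\infty]$ that contracts ${\mathbb R}/{\mathbb Z}\times\{\infty\}$ to one point and ${\mathbb R}/{\mathbb Z}\times\{-\infty\}$ to another one, and define $\alpha'\colon S^2\to {\bf P}^2({\mathbb C})$ by $$\alpha'(t,u) := \gamma(t) + \mathrm{i}\,u\,b \in {\mathbb C}^2 \subset {\bf P}^2({\mathbb C})$$ for $u \in {\mathbb R}$ and $\gamma(t)$ in the chart, and by letting $\alpha'(t,u)$ be the point at infinity in direction $b$ if $u=\pm\infty$ or if $\gamma(t)$ is at infinity. Then $\alpha'$ is continuous and lifts to a continuous map $\widetilde\alpha\colon S^2\to X'$, i.e. $\pi\circ\widetilde\alpha = \alpha'$, where $$X' := \{[v:w] \in {\bf P}(1,1,1,3)({\mathbb C}) \mid w^2 = l_1(v)\cdots l_6(v)\}$$ is the double cover of ${\bf P}^2({\mathbb C})$ ramified at the union of the six lines, with the topology induced by the analytic one, and $\pi\colon [v:w]\mapsto [v]$. -/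

import Mathlib

open Set Filter Topology Matrix

noncomputable section

/-! ### Projective planes and lines -/

/-- Quotient topology on a projective space. -/
instance projectivizationTopology (K V : Type*) [DivisionRing K] [AddCommGroup V] [Module K V]
    [TopologicalSpace V] : TopologicalSpace (Projectivization K V) :=
  inferInstanceAs (TopologicalSpace (Quotient (projectivizationSetoid K V)))

/-- The real projective plane. -/
abbrev RP2 : Type := Projectivization ℝ (Fin 3 → ℝ)

/-- The complex projective plane. -/
abbrev CP2 : Type := Projectivization ℂ (Fin 3 → ℂ)

/-- A real vector, regarded as a complex one. -/
def toC {n : ℕ} (v : Fin n → ℝ) : Fin n → ℂ := fun k => (v k : ℂ)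

theorem toC_ne_zero {n : ℕ} {v : Fin n → ℝ} (hv : v ≠ 0) : toC v ≠ 0 := by
  intro h
  apply hv
  funext k
  have := congrFun h k
  simpa [toC] using this

/-- The real linear form with coefficient vector `a`, evaluated at a complex vector. -/
def complexForm (a : Fin 3 → ℝ) (v : Fin 3 → ℂ) : ℂ := toC a ⬝ᵥ v

/-- The complex points of the line `V(a)`. -/
def complexLine (a : Fin 3 → ℝ) : Set CP2 := {p | complexForm a p.rep = 0}

/-- The real points of the line `V(a)`. -/
def realLine (a : Fin 3 → ℝ) : Set RP2 := {p | a ⬝ᵥ p.rep = 0}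

/-- The forms `L 0, …, L 5` define six lines, no three of which have a point in common. -/
def NoThreeConcurrent (L : Fin 6 → Fin 3 → ℝ) : Prop :=
  (∀ i, L i ≠ 0) ∧
    ∀ i j k, i ≠ j → i ≠ k → j ≠ k →
      complexLine (L i) ∩ complexLine (L j) ∩ complexLine (L k) = ∅

/-! ### The double cover `w² = l₁ ⋯ l₆` -/

/-- The affine cone, without its vertex, over the surface `w² = l₁ ⋯ l₆` in the weighted
projective space `P(1,1,1,3)`. (As `w ^ 2 = 0` where `v = 0`, the vertex is excluded by `v ≠ 0`.) -/
def DoubleCoverCone (L : Fin 6 → Fin 3 → ℝ) : Type :=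
  {p : (Fin 3 → ℂ) × ℂ // p.1 ≠ 0 ∧ p.2 ^ 2 = ∏ i, complexForm (L i) p.1}

instance (L : Fin 6 → Fin 3 → ℝ) : TopologicalSpace (DoubleCoverCone L) :=
  inferInstanceAs (TopologicalSpace
    {p : (Fin 3 → ℂ) × ℂ // p.1 ≠ 0 ∧ p.2 ^ 2 = ∏ i, complexForm (L i) p.1})

/-- Two points of the cone are identified when they differ by the weighted scaling
`(v, w) ↦ (c v, c³ w)`. -/
def doubleCoverSetoid (L : Fin 6 → Fin 3 → ℝ) : Setoid (DoubleCoverCone L) where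
  r p q := ∃ c : ℂ, c ≠ 0 ∧ q.1.1 = c • p.1.1 ∧ q.1.2 = c ^ 3 * p.1.2
  iseqv :=
    { refl := fun p => ⟨1, one_ne_zero, by simp, by simp⟩
      symm := by
        rintro p q ⟨c, hc, h1, h2⟩
        refine ⟨c⁻¹, inv_ne_zero hc, ?_, ?_⟩
        · rw [h1, smul_smul, inv_mul_cancel₀ hc, one_smul]
        · rw [h2]; field_simp
      trans := by
        rintro p q r ⟨c, hc, h1, h2⟩ ⟨d, hd, h3, h4⟩
        refine ⟨d * c, mul_ne_zero hd hc, ?_, ?_⟩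
        · rw [h3, h1, smul_smul]
        · rw [h4, h2]; ring }

/-- The double cover `X' : w² = l₁ ⋯ l₆` of the complex projective plane. -/
def DoubleCover (L : Fin 6 → Fin 3 → ℝ) : Type := Quotient (doubleCoverSetoid L)

instance (L : Fin 6 → Fin 3 → ℝ) : TopologicalSpace (DoubleCover L) :=
  inferInstanceAs (TopologicalSpace (Quotient (doubleCoverSetoid L)))

/-- The covering map `X' → P²(ℂ)`, `[v : w] ↦ [v]`. -/
def coverMap (L : Fin 6 → Fin 3 → ℝ) : DoubleCover L → CP2 :=
  Quotient.lift (fun p : DoubleCoverCone L => Projectivization.mk ℂ p.1.1 p.2.1) (by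
    rintro p q ⟨c, hc, h1, -⟩
    refine (Projectivization.mk_eq_mk_iff' ℂ _ _ _ _).2 ⟨c⁻¹, ?_⟩
    rw [h1, smul_smul, inv_mul_cancel₀ hc, one_smul])

/-! ### The closed curves in the real projective plane -/

/-- The curve `γ` crosses the line `V(a)` at the parameter `t`: an affine equation `a / m` of
`V(a)`, on an affine chart `m ≠ 0` around `γ t`, changes its sign along `γ` at `t`. -/
def CrossesAt (a : Fin 3 → ℝ) (γ : AddCircle (1 : ℝ) → RP2) (t : AddCircle (1 : ℝ)) : Prop :=
  ∃ m : Fin 3 → ℝ, m ⬝ᵥ (γ t).rep ≠ 0 ∧ ∃ ε : ℝ, (ε = 1 ∨ ε = -1) ∧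
    (∀ᶠ s : ℝ in 𝓝[>] 0,
      0 < ε * ((a ⬝ᵥ (γ (t + (s : AddCircle (1 : ℝ)))).rep) /
        (m ⬝ᵥ (γ (t + (s : AddCircle (1 : ℝ)))).rep))) ∧
    (∀ᶠ s : ℝ in 𝓝[<] 0,
      ε * ((a ⬝ᵥ (γ (t + (s : AddCircle (1 : ℝ)))).rep) /
        (m ⬝ᵥ (γ (t + (s : AddCircle (1 : ℝ)))).rep)) < 0)

/-- A closed curve in `P²(ℝ)` that meets the six lines only in their double points and crosses, in
each double point that it meets, both of the lines through that point. (The curve passes there from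
one of the four sectors to the opposite one.) -/
structure IsAdmissibleCurve (L : Fin 6 → Fin 3 → ℝ) (γ : AddCircle (1 : ℝ) → RP2) : Prop where
  continuous : Continuous γ
  double_point : ∀ t i, γ t ∈ realLine (L i) → ∃ j, j ≠ i ∧ γ t ∈ realLine (L j)
  crosses : ∀ t i, γ t ∈ realLine (L i) → CrossesAt (L i) γ t

/-! ### Affine charts

A matrix `C ∈ GL₃(ℝ)` gives the affine chart `(x, y) ↦ [C (x, y, 1)]` of the projective plane. -/

/-- The homogeneous coordinate vector of the point `x` of the affine chart. -/
def affineVec (C : GL (Fin 3) ℝ) (x : Fin 2 → ℝ) : Fin 3 → ℝ := C.1 *ᵥ ![x 0, x 1, 1]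

/-- The homogeneous coordinate vector of the point `z` of the complexified affine chart. -/
def complexAffineVec (C : GL (Fin 3) ℝ) (z : Fin 2 → ℂ) : Fin 3 → ℂ :=
  C.1.map (fun r : ℝ => (r : ℂ)) *ᵥ ![z 0, z 1, 1]

/-- The homogeneous coordinate vector of the point at infinity in direction `b`. -/
def directionVec (C : GL (Fin 3) ℝ) (b : Fin 2 → ℝ) : Fin 3 → ℝ := C.1 *ᵥ ![b 0, b 1, 0]

/-- The coordinate of `v` the vanishing of which means that `[v]` is at infinity. -/
def infinityForm (C : GL (Fin 3) ℝ) (v : Fin 3 → ℝ) : ℝ := ((C⁻¹).1 *ᵥ v) 2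

/-- The point `p` lies on the line at infinity of the chart. -/
def AtInfinity (C : GL (Fin 3) ℝ) (p : RP2) : Prop := infinityForm C p.rep = 0

/-- The affine chart meets the line `V(a)`. -/
def ChartMeets (C : GL (Fin 3) ℝ) (a : Fin 3 → ℝ) : Prop :=
  ∃ p ∈ realLine a, ¬ AtInfinity C p

theorem GL_inv_mulVec (C : GL (Fin 3) ℝ) (v : Fin 3 → ℝ) : (C⁻¹).1 *ᵥ (C.1 *ᵥ v) = v := by
  rw [Matrix.mulVec_mulVec]
  have : (C⁻¹).1 * C.1 = 1 := by
    rw [← Units.val_mul, inv_mul_cancel, Units.val_one]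
  rw [this, Matrix.one_mulVec]

theorem infinityForm_affineVec (C : GL (Fin 3) ℝ) (x : Fin 2 → ℝ) :
    infinityForm C (affineVec C x) = 1 := by
  simp [infinityForm, affineVec]

theorem affineVec_ne_zero (C : GL (Fin 3) ℝ) (x : Fin 2 → ℝ) : affineVec C x ≠ 0 := by
  intro h
  have := infinityForm_affineVec C x
  rw [h] at this
  simp [infinityForm] at this

theorem directionVec_ne_zero (C : GL (Fin 3) ℝ) {b : Fin 2 → ℝ} (hb : b ≠ 0) :
    directionVec C b ≠ 0 := by
  intro h
  have h1 := GL_inv_mulVec C ![b 0, b 1, 0]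
  rw [show C.1 *ᵥ ![b 0, b 1, 0] = 0 from h, Matrix.mulVec_zero] at h1
  apply hb
  funext k
  fin_cases k
  · simpa using (congrFun h1 0).symm
  · simpa using (congrFun h1 1).symm

/-- The coefficients `(A₁, A₂, A₃)` of the affine equation `A₁ x + A₂ y + A₃ = 0` of the line
`V(a)` in the chart. -/
def affineCoeffs (C : GL (Fin 3) ℝ) (a : Fin 3 → ℝ) : Fin 3 → ℝ := a ᵥ* C.1

/-- The union `E` of the directions `span (A₂, -A₁)` of the six lines. -/
def exceptionalSet (C : GL (Fin 3) ℝ) (L : Fin 6 → Fin 3 → ℝ) : Set (Fin 2 → ℝ) :=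
  ⋃ i, (Submodule.span ℝ {![affineCoeffs C (L i) 1, - affineCoeffs C (L i) 0]} :
    Set (Fin 2 → ℝ))

theorem ne_zero_of_notMem_exceptionalSet {C : GL (Fin 3) ℝ} {L : Fin 6 → Fin 3 → ℝ}
    {b : Fin 2 → ℝ} (hb : b ∉ exceptionalSet C L) : b ≠ 0 := by
  rintro rfl
  exact hb (Set.mem_iUnion.2 ⟨0, Submodule.zero_mem _⟩)

/-! ### The suspension of the circle -/

/-- On `ℝ/ℤ × [-∞, ∞]`, the circle over `∞` and the circle over `-∞` are each contracted to a
point. -/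
def suspensionSetoid : Setoid (AddCircle (1 : ℝ) × EReal) where
  r p q := p.2 = q.2 ∧ (p.1 = q.1 ∨ p.2 = ⊤ ∨ p.2 = ⊥)
  iseqv :=
    { refl := fun _ => ⟨rfl, Or.inl rfl⟩
      symm := by
        rintro p q ⟨h, h'⟩
        refine ⟨h.symm, ?_⟩
        rw [← h]
        exact h'.imp_left Eq.symm
      trans := by
        rintro p q r ⟨h, h'⟩ ⟨k, k'⟩
        refine ⟨h.trans k, ?_⟩
        rcases h' with h' | h'
        · rw [h', h]; exact k'
        · exact Or.inr h' }

/-- The suspension of the circle `ℝ/ℤ`. -/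
def Suspension : Type := Quotient suspensionSetoid

instance : TopologicalSpace Suspension :=
  inferInstanceAs (TopologicalSpace (Quotient suspensionSetoid))

/-- The unit sphere `S²`. -/
abbrev Sphere2 : Type := Metric.sphere (0 : EuclideanSpace ℝ (Fin 3)) 1

/-- The latitude that corresponds to a point of `[-∞, ∞]`. -/
def latitude (u : EReal) : ℝ :=
  if u = ⊤ then Real.pi / 2 else if u = ⊥ then -(Real.pi / 2) else Real.arctan u.toReal

theorem latitude_coe (x : ℝ) : latitude (x : EReal) = Real.arctan x := by
  simp [latitude]

theorem latitude_top : latitude ⊤ = Real.pi / 2 := by simp [latitude]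

theorem latitude_bot : latitude ⊥ = -(Real.pi / 2) := by simp [latitude]

theorem latitude_mem (u : EReal) : latitude u ∈ Icc (-(Real.pi / 2)) (Real.pi / 2) := by
  have := Real.pi_pos
  induction u with
  | bot => rw [latitude_bot]; constructor <;> linarith
  | top => rw [latitude_top]; constructor <;> linarith
  | coe x =>
    rw [latitude_coe]
    exact ⟨(Real.neg_pi_div_two_lt_arctan x).le, (Real.arctan_lt_pi_div_two x).le⟩

theorem latitude_strictMono : StrictMono latitude := by
  have := Real.pi_pos
  intro u v h
  induction u with
  | top => exact absurd h not_top_lt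
  | bot =>
    induction v with
    | bot => exact absurd h (lt_irrefl _)
    | top => rw [latitude_bot, latitude_top]; linarith
    | coe y => rw [latitude_bot, latitude_coe]; exact Real.neg_pi_div_two_lt_arctan y
  | coe x =>
    induction v with
    | bot => exact absurd h not_lt_bot
    | top => rw [latitude_coe, latitude_top]; exact Real.arctan_lt_pi_div_two x
    | coe y =>
      rw [latitude_coe, latitude_coe]
      exact Real.arctan_strictMono (EReal.coe_lt_coe_iff.1 h)

theorem latitude_surj {φ : ℝ} (h : φ ∈ Icc (-(Real.pi / 2)) (Real.pi / 2)) :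
    ∃ u, latitude u = φ := by
  rcases eq_or_lt_of_le h.1 with h1 | h1
  · exact ⟨⊥, by rw [latitude_bot, h1]⟩
  rcases eq_or_lt_of_le h.2 with h2 | h2
  · exact ⟨⊤, by rw [latitude_top, h2]⟩
  exact ⟨(Real.tan φ : ℝ), by rw [latitude_coe, Real.arctan_tan h1 h2]⟩

theorem latitude_continuous : Continuous latitude := by
  let f : EReal → Icc (-(Real.pi / 2)) (Real.pi / 2) := fun u => ⟨latitude u, latitude_mem u⟩
  have hm : StrictMono f := fun u v h => latitude_strictMono h
  have hs : Function.Surjective f := by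
    rintro ⟨φ, h⟩
    obtain ⟨u, hu⟩ := latitude_surj h
    exact ⟨u, Subtype.ext hu⟩
  have hf : Continuous f := hm.monotone.continuous_of_surjective hs
  exact continuous_subtype_val.comp hf

theorem cos_latitude_eq_zero {u : EReal} (h : Real.cos (latitude u) = 0) : u = ⊤ ∨ u = ⊥ := by
  induction u with
  | top => exact Or.inl rfl
  | bot => exact Or.inr rfl
  | coe x =>
    rw [latitude_coe] at h
    exact absurd h (Real.cos_arctan_pos x).ne'

/-- The point of `S²` with longitude `2πt` and latitude `latitude u`. -/
def spherePoint (p : AddCircle (1 : ℝ) × EReal) : Sphere2 :=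
  ⟨!₂[Real.cos (latitude p.2) * (p.1.toCircle : ℂ).re,
      Real.cos (latitude p.2) * (p.1.toCircle : ℂ).im, Real.sin (latitude p.2)], by
    have h1 : (p.1.toCircle : ℂ).re ^ 2 + (p.1.toCircle : ℂ).im ^ 2 = 1 := by
      have := Circle.normSq_coe p.1.toCircle
      rw [Complex.normSq_apply] at this
      nlinarith
    have h2 := Real.sin_sq_add_cos_sq (latitude p.2)
    rw [mem_sphere_zero_iff_norm, EuclideanSpace.norm_eq, Real.sqrt_eq_one]
    simp only [Fin.sum_univ_three, Real.norm_eq_abs, sq_abs]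
    simp only [PiLp.toLp_apply, Matrix.cons_val]
    linear_combination (Real.cos (latitude p.2)) ^ 2 * h1 + h2⟩

theorem spherePoint_continuous : Continuous spherePoint := by
  unfold spherePoint
  refine Continuous.subtype_mk ?_ _
  have hl : Continuous fun p : AddCircle (1 : ℝ) × EReal => latitude p.2 :=
    latitude_continuous.comp continuous_snd
  have hc : Continuous fun p : AddCircle (1 : ℝ) × EReal => (p.1.toCircle : ℂ) :=
    continuous_subtype_val.comp (AddCircle.continuous_toCircle.comp continuous_fst)
  refine (PiLp.continuous_toLp 2 _).comp ?_
  refine continuous_pi fun k => ?_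
  fin_cases k
  · exact (Real.continuous_cos.comp hl).mul (Complex.continuous_re.comp hc)
  · exact (Real.continuous_cos.comp hl).mul (Complex.continuous_im.comp hc)
  · exact Real.continuous_sin.comp hl

theorem spherePoint_eq_iff (p q : AddCircle (1 : ℝ) × EReal) :
    spherePoint p = spherePoint q ↔ suspensionSetoid.r p q := by
  constructor
  · intro h
    have h' : ∀ k : Fin 3, (spherePoint p).1 k = (spherePoint q).1 k := fun k => by rw [h]
    have h0 := h' 0
    have h1 := h' 1
    have h2 := h' 2
    simp only [spherePoint, Matrix.cons_val] at h0 h1 h2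
    have hlat : latitude p.2 = latitude q.2 :=
      Real.injOn_sin (latitude_mem _) (latitude_mem _) h2
    have hpq : p.2 = q.2 := latitude_strictMono.injective hlat
    refine ⟨hpq, ?_⟩
    by_cases hc : Real.cos (latitude p.2) = 0
    · exact Or.inr (cos_latitude_eq_zero hc)
    · left
      rw [← hlat] at h0 h1
      have hz : (p.1.toCircle : ℂ) = q.1.toCircle :=
        Complex.ext (mul_left_cancel₀ hc h0) (mul_left_cancel₀ hc h1)
      exact AddCircle.injective_toCircle one_ne_zero (Subtype.ext hz)
  · rintro ⟨h, h'⟩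
    apply Subtype.ext
    rcases h' with h' | h'
    · rw [Prod.ext h' h]
    · have hc : Real.cos (latitude p.2) = 0 := by
        rcases h' with h' | h' <;> rw [h']
        · rw [latitude_top, Real.cos_pi_div_two]
        · rw [latitude_bot, Real.cos_neg, Real.cos_pi_div_two]
      simp only [spherePoint, ← h, hc, zero_mul]

theorem spherePoint_surjective : Function.Surjective spherePoint := by
  rintro ⟨y, hy⟩
  have hy' : y 0 ^ 2 + y 1 ^ 2 + y 2 ^ 2 = 1 := by
    rw [mem_sphere_zero_iff_norm, EuclideanSpace.norm_eq, Real.sqrt_eq_one] at hy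
    simpa [Fin.sum_univ_three] using hy
  have hz : -1 ≤ y 2 ∧ y 2 ≤ 1 := by
    constructor <;> nlinarith [sq_nonneg (y 0), sq_nonneg (y 1)]
  obtain ⟨u, hu⟩ := latitude_surj (Real.arcsin_mem_Icc (y 2))
  have hs : Real.sin (latitude u) = y 2 := by rw [hu, Real.sin_arcsin hz.1 hz.2]
  have hsc := Real.sin_sq_add_cos_sq (latitude u)
  rw [hs] at hsc
  by_cases hc : Real.cos (latitude u) = 0
  · refine ⟨(0, u), Subtype.ext ?_⟩
    rw [hc] at hsc
    have h0 : y 0 = 0 := by nlinarith [sq_nonneg (y 0), sq_nonneg (y 1)]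
    have h1 : y 1 = 0 := by nlinarith [sq_nonneg (y 0), sq_nonneg (y 1)]
    ext k
    fin_cases k
    · simp [spherePoint, hc, h0]
    · simp [spherePoint, hc, h1]
    · simp [spherePoint, hs]
  · set c := Real.cos (latitude u) with hcdef
    have hmem : (⟨y 0 / c, y 1 / c⟩ : ℂ) ∈ Submonoid.unitSphere ℂ := by
      rw [Submonoid.unitSphere, Submonoid.mem_mk]
      change _ ∈ Metric.sphere (0 : ℂ) 1
      rw [mem_sphere_zero_iff_norm, ← sq_eq_sq₀ (norm_nonneg _) zero_le_one,
        ← Complex.normSq_eq_norm_sq, Complex.normSq_mk]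
      field_simp
      linarith
    obtain ⟨t, ht⟩ := (AddCircle.homeomorphCircle (one_ne_zero : (1 : ℝ) ≠ 0)).surjective
      ⟨⟨y 0 / c, y 1 / c⟩, hmem⟩
    rw [AddCircle.homeomorphCircle_apply] at ht
    refine ⟨(t, u), Subtype.ext ?_⟩
    ext k
    fin_cases k
    · simp only [spherePoint, ht, ← hcdef]
      simp [mul_div_cancel₀ _ hc]
    · simp only [spherePoint, ht, ← hcdef]
      simp [mul_div_cancel₀ _ hc]
    · simp [spherePoint, hs]

/-- The suspension of the circle is a sphere, the two contracted circles being its poles. -/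
def suspensionHomeo : Suspension ≃ₜ Sphere2 :=
  haveI : CompactSpace Suspension := inferInstanceAs (CompactSpace (Quotient suspensionSetoid))
  Continuous.homeoOfEquivCompactToT2
    (f := Equiv.ofBijective
      (Quotient.lift spherePoint fun p q h => (spherePoint_eq_iff p q).2 h)
      ⟨by
        rintro ⟨p⟩ ⟨q⟩ h
        exact Quotient.sound ((spherePoint_eq_iff p q).1 h), by
        intro y
        obtain ⟨p, hp⟩ := spherePoint_surjective y
        exact ⟨Quotient.mk _ p, hp⟩⟩)
    (spherePoint_continuous.quotient_lift _)

/-! ### The spheroids -/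

/-- The vector `v + i u m(v) (b, 0)`, for `m` the form that defines the line at infinity. For a real
point `[v] = [(x, 1)]` of the chart, it represents the point `x + i u b`. -/
def spheroidVec (C : GL (Fin 3) ℝ) (b : Fin 2 → ℝ) (v : Fin 3 → ℝ) (u : ℝ) : Fin 3 → ℂ :=
  toC v + (Complex.I * (u : ℂ) * (infinityForm C v : ℂ)) • toC (directionVec C b)

theorem spheroidVec_ne_zero (C : GL (Fin 3) ℝ) (b : Fin 2 → ℝ) {v : Fin 3 → ℝ} (hv : v ≠ 0)
    (u : ℝ) : spheroidVec C b v u ≠ 0 := by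
  intro h
  apply hv
  funext k
  have := congrArg Complex.re (congrFun h k)
  simpa [spheroidVec, toC] using this

/-- The point at infinity in direction `b`, in `P²(ℝ)`. -/
def directionPoint (C : GL (Fin 3) ℝ) {b : Fin 2 → ℝ} (hb : b ≠ 0) : RP2 :=
  Projectivization.mk ℝ (directionVec C b) (directionVec_ne_zero C hb)

/-- The value at `(t, u) ∈ ℝ/ℤ × [-∞, ∞]`: the point `γ t + i u b` of the chart for `u ∈ ℝ` (see
`spheroidFun_affine`), and the point at infinity in direction `b` for `u = ±∞`. -/
def spheroidFun (C : GL (Fin 3) ℝ) {b : Fin 2 → ℝ} (hb : b ≠ 0) (γ : AddCircle (1 : ℝ) → RP2)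
    (p : AddCircle (1 : ℝ) × EReal) : CP2 :=
  if p.2 = ⊤ ∨ p.2 = ⊥ then
    Projectivization.mk ℂ (toC (directionVec C b)) (toC_ne_zero (directionVec_ne_zero C hb))
  else
    Projectivization.mk ℂ (spheroidVec C b (γ p.1).rep p.2.toReal)
      (spheroidVec_ne_zero C b (γ p.1).rep_nonzero p.2.toReal)

/-- The map from the suspension of the circle to `P²(ℂ)` given by `γ` and `b`. -/
def suspensionSpheroid (C : GL (Fin 3) ℝ) {b : Fin 2 → ℝ} (hb : b ≠ 0)
    (γ : AddCircle (1 : ℝ) → RP2) : Suspension → CP2 :=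
  Quotient.lift (spheroidFun C hb γ) (by
    rintro p q ⟨h, h'⟩
    unfold spheroidFun
    by_cases hp : p.2 = ⊤ ∨ p.2 = ⊥
    · rw [if_pos hp, if_pos (h ▸ hp)]
    · have h1 : p.1 = q.1 := h'.resolve_right hp
      rw [Prod.ext h1 h])

/-- The spheroid `α' : S² → P²(ℂ)`. -/
def spheroid (C : GL (Fin 3) ℝ) {b : Fin 2 → ℝ} (hb : b ≠ 0)
    (γ : AddCircle (1 : ℝ) → RP2) : Sphere2 → CP2 :=
  suspensionSpheroid C hb γ ∘ suspensionHomeo.symm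

theorem complexAffineVec_eq (C : GL (Fin 3) ℝ) (b x : Fin 2 → ℝ) (u : ℝ) :
    complexAffineVec C (fun k => (x k : ℂ) + Complex.I * (u : ℂ) * (b k : ℂ)) =
      spheroidVec C b (affineVec C x) u := by
  rw [spheroidVec, infinityForm_affineVec]
  funext k
  simp only [complexAffineVec, affineVec, directionVec, toC, Matrix.mulVec, dotProduct,
    Fin.sum_univ_three, Matrix.map_apply, Matrix.cons_val, Pi.add_apply, Pi.smul_apply, smul_eq_mul,
    Complex.ofReal_add, Complex.ofReal_mul, Complex.ofReal_one, Complex.ofReal_zero]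
  ring

/-- If `γ t` is the point `x` of the affine chart then the value at `(t, u)` is the point
`x + i u b` of the complexified affine chart. -/
theorem spheroidFun_affine (C : GL (Fin 3) ℝ) {b : Fin 2 → ℝ} (hb : b ≠ 0)
    (γ : AddCircle (1 : ℝ) → RP2) (t : AddCircle (1 : ℝ)) (u : ℝ) (x : Fin 2 → ℝ)
    (hx : γ t = Projectivization.mk ℝ (affineVec C x) (affineVec_ne_zero C x)) :
    ∃ h : complexAffineVec C (fun k => (x k : ℂ) + Complex.I * (u : ℂ) * (b k : ℂ)) ≠ 0,
      spheroidFun C hb γ (t, (u : EReal)) = Projectivization.mk ℂ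
        (complexAffineVec C (fun k => (x k : ℂ) + Complex.I * (u : ℂ) * (b k : ℂ))) h := by
  have h0 := complexAffineVec_eq C b x u
  refine ⟨h0 ▸ spheroidVec_ne_zero C b (affineVec_ne_zero C x) u, ?_⟩
  have hu : ¬ ((u : EReal) = ⊤ ∨ (u : EReal) = ⊥) := by simp
  unfold spheroidFun
  rw [if_neg hu, Projectivization.mk_eq_mk_iff']
  obtain ⟨c, hc⟩ := Projectivization.exists_smul_eq_mk_rep ℝ (affineVec C x) (affineVec_ne_zero C x)
  refine ⟨((c : ℝ) : ℂ), ?_⟩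
  simp only [h0, hx, ← hc, EReal.toReal_coe]
  funext k
  simp only [spheroidVec, toC, infinityForm, Matrix.mulVec_smul, Pi.add_apply, Pi.smul_apply,
    smul_eq_mul, Units.smul_def, Complex.ofReal_mul]
  ring

end

/-! Write `z_i` for the affine form `L i / L i (b)`; the denominator is nonzero because `b` avoids
`E`. At the point `γ t + i u b` it takes the value `s_i(t) + i u` with `s_i(t)` real. So all six
values have the same imaginary part `u`: they lie together in the upper half plane for `u > 0` and
in the lower one for `u < 0`. On each closed half plane the square root has a continuous branch, and
the product of the six roots, times a square root `κ` of `∏ L i (b)`, is a square root of `l₁ ⋯ l₆`.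

What remains is gluing. On the real axis the branches from above and from below are conjugate, and
conjugation multiplies the root of a real number by its sign. Hence the two products differ at `u =
0` by the sign of `∏ s_i(t)` (`prod_upperSqrt_ofReal`). As `γ` crosses exactly two lines at each
double point, this sign is a constant `ε` (`IsAdmissibleCurve.exists_sign`), and multiplying the
lower root by `ε` makes the choice continuous.

Near the point at infinity, scale by `1 / z_0`. The root becomes `κ` times the hemisphere sign times
`∏ √z_i / √z_0`. Each ratio has nonnegative real part and its square tends to 1, so the ratio tends
to 1, not to -1 (`tendsto_liftScale_mul_liftRoot`). If `γ` itself passes through infinity, the sign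
must not jump at `u = 0` there. Indeed `ε = 1` in that case, since six, the number of forms, is even
(`IsAdmissibleCurve.exists_slopeCoord_sign`). -/

noncomputable section

/-! ### Square roots on half planes -/

/-- A continuous function on `ℂ` whose square is `z` on the closed upper half plane. -/
def upperSqrt (z : ℂ) : ℂ := ⟨√((‖z‖ + z.re) / 2), √((‖z‖ - z.re) / 2)⟩

theorem continuous_upperSqrt : Continuous upperSqrt := by
  have h : upperSqrt = fun z : ℂ =>
      ((√((‖z‖ + z.re) / 2) : ℝ) : ℂ) + ((√((‖z‖ - z.re) / 2) : ℝ) : ℂ) * Complex.I := by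
    funext z
    apply Complex.ext <;> simp [upperSqrt]
  rw [h]
  fun_prop

theorem upperSqrt_sq {z : ℂ} (hz : 0 ≤ z.im) : upperSqrt z ^ 2 = z := by
  have h1 := neg_le_of_abs_le (Complex.abs_re_le_norm z)
  have h2 := le_of_abs_le (Complex.abs_re_le_norm z)
  have ha : 0 ≤ (‖z‖ + z.re) / 2 := by linarith
  have hb : 0 ≤ (‖z‖ - z.re) / 2 := by linarith
  have hn : ‖z‖ ^ 2 = z.re ^ 2 + z.im ^ 2 := by
    rw [← Complex.normSq_eq_norm_sq, Complex.normSq_apply]; ring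
  apply Complex.ext
  · simp only [upperSqrt, pow_two, Complex.mul_re, Real.mul_self_sqrt ha, Real.mul_self_sqrt hb]
    ring
  · simp only [upperSqrt, pow_two, Complex.mul_im]
    rw [← Real.sqrt_mul ha, ← Real.sqrt_mul hb,
      show (‖z‖ + z.re) / 2 * ((‖z‖ - z.re) / 2) = (z.im / 2) ^ 2 by linear_combination hn / 4,
      show (‖z‖ - z.re) / 2 * ((‖z‖ + z.re) / 2) = (z.im / 2) ^ 2 by linear_combination hn / 4,
      Real.sqrt_sq (by linarith)]
    ring

/-- The formula involves only the norm and the real part. Therefore the conjugate of `upperSqrt` is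
a square root on the closed lower half plane. -/
theorem upperSqrt_conj (z : ℂ) : upperSqrt (starRingEnd ℂ z) = upperSqrt z := by
  simp [upperSqrt]

/-- The root is real for `a ≥ 0` and imaginary for `a ≤ 0`, so conjugation multiplies it by the sign
of `a`. The factors `|a|` and `a` encode this sign without a division. -/
theorem conj_upperSqrt_ofReal_mul (a : ℝ) :
    starRingEnd ℂ (upperSqrt a) * (|a| : ℝ) = upperSqrt a * a := by
  rcases le_total 0 a with h | h
  · apply Complex.ext <;> simp [upperSqrt, abs_of_nonneg h]
  · apply Complex.ext <;> simp [upperSqrt, abs_of_nonpos h]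

/-- A square root, continuous on the closed upper and on the open lower half plane. -/
def halfSqrt (z : ℂ) : ℂ := if 0 ≤ z.im then upperSqrt z else starRingEnd ℂ (upperSqrt z)

theorem halfSqrt_sq (z : ℂ) : halfSqrt z ^ 2 = z := by
  unfold halfSqrt
  split_ifs with h
  · exact upperSqrt_sq h
  · rw [← upperSqrt_conj, ← map_pow, upperSqrt_sq, Complex.conj_conj]
    rw [Complex.conj_im]
    linarith

/-- Equal imaginary parts select the same branch, whose values fill one closed quadrant, so the
arguments of the two roots differ by at most a right angle. -/
theorem re_halfSqrt_div_nonneg {z w : ℂ} (h : z.im = w.im) :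
    0 ≤ (halfSqrt z / halfSqrt w).re := by
  have aux : ∀ z w : ℂ, 0 ≤ (upperSqrt z / upperSqrt w).re := by
    intro z w
    rw [Complex.div_re]
    simp only [upperSqrt]
    have := Complex.normSq_nonneg ⟨√((‖w‖ + w.re) / 2), √((‖w‖ - w.re) / 2)⟩
    positivity
  unfold halfSqrt
  rw [h]
  split_ifs
  · exact aux z w
  · rw [← map_div₀, Complex.conj_re]
    exact aux z w

/-- On the right half plane `r + 1` has modulus at least 1. Thus `r ^ 2 → 1` forces `r → 1` and
rules out `-1`. -/
theorem norm_sub_one_le_of_re_nonneg {r : ℂ} (hr : 0 ≤ r.re) : ‖r - 1‖ ≤ ‖r ^ 2 - 1‖ := by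
  have h : 1 ≤ ‖r + 1‖ := by
    have := Complex.re_le_norm (r + 1)
    simp only [Complex.add_re, Complex.one_re] at this
    linarith
  rw [show r ^ 2 - 1 = (r - 1) * (r + 1) by ring, norm_mul]
  exact le_mul_of_one_le_right (norm_nonneg _) h

/-- Square roots from above and from below the real axis of a product of real numbers. -/
theorem prod_upperSqrt_ofReal {ι : Type*} (s : Finset ι) (a : ι → ℝ) {ε : ℝ}
    (hε : ε = 1 ∨ ε = -1) (h : 0 ≤ ε * ∏ i ∈ s, a i) :
    (ε : ℂ) * ∏ i ∈ s, starRingEnd ℂ (upperSqrt (a i)) = ∏ i ∈ s, upperSqrt (a i) := by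
  -- If a factor vanishes, both sides are 0; otherwise the product of the `a i` can be cancelled.
  by_cases h0 : ∏ i ∈ s, a i = 0
  · obtain ⟨i, hi, hi0⟩ := Finset.prod_eq_zero_iff.1 h0
    have hz : upperSqrt (a i) = 0 := by
      have := upperSqrt_sq (z := (a i : ℂ)) (by simp)
      rw [hi0] at this ⊢
      simpa using this
    rw [Finset.prod_eq_zero hi (by rw [hz, map_zero]), Finset.prod_eq_zero hi hz, mul_zero]
  · have habs : |∏ i ∈ s, a i| = ε * ∏ i ∈ s, a i := by
      rw [← abs_of_nonneg h, abs_mul]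
      rcases hε with rfl | rfl <;> simp
    have hprod : (∏ i ∈ s, starRingEnd ℂ (upperSqrt (a i))) * ((∏ i ∈ s, |a i| : ℝ) : ℂ) =
        (∏ i ∈ s, upperSqrt (a i)) * ((∏ i ∈ s, a i : ℝ) : ℂ) := by
      push_cast
      rw [← Finset.prod_mul_distrib, ← Finset.prod_mul_distrib]
      exact Finset.prod_congr rfl fun i _ => conj_upperSqrt_ofReal_mul (a i)
    rw [← Finset.abs_prod, habs] at hprod
    apply mul_right_cancel₀ (Complex.ofReal_ne_zero.2 h0)
    rw [← hprod]
    push_cast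
    ring

/-! ### Normalised coordinates on the real projective plane -/

theorem isQuotientMap_projectivization_mk' (K V : Type*) [DivisionRing K] [AddCommGroup V]
    [Module K V] [TopologicalSpace V] :
    IsQuotientMap (Projectivization.mk' K : {v : V // v ≠ 0} → Projectivization K V) :=
  isQuotientMap_quotient_mk'

/-- The representative of `p` at which the linear form `m` takes the value `1`. -/
def normRep (m : Fin 3 → ℝ) (p : RP2) : Fin 3 → ℝ := (m ⬝ᵥ p.rep)⁻¹ • p.rep

theorem exists_rep_mk_eq (v : {v : Fin 3 → ℝ // v ≠ 0}) :
    ∃ c : ℝ, c ≠ 0 ∧ (Projectivization.mk' ℝ v).rep = c • v.1 := by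
  obtain ⟨c, hc⟩ := Projectivization.exists_smul_eq_mk_rep ℝ v.1 v.2
  exact ⟨c, c.ne_zero, hc.symm⟩

theorem isOpen_dotProduct_rep_ne_zero (m : Fin 3 → ℝ) : IsOpen {p : RP2 | m ⬝ᵥ p.rep ≠ 0} := by
  rw [← (isQuotientMap_projectivization_mk' ℝ (Fin 3 → ℝ)).isOpen_preimage]
  have : Projectivization.mk' ℝ ⁻¹' {p : RP2 | m ⬝ᵥ p.rep ≠ 0} =
      {v : {v : Fin 3 → ℝ // v ≠ 0} | m ⬝ᵥ v.1 ≠ 0} := by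
    ext v
    obtain ⟨c, hc, h⟩ := exists_rep_mk_eq v
    simp only [mem_preimage, mem_ofPred_eq, h, dotProduct_smul, smul_eq_mul]
    simp [hc]
  rw [this]
  exact isOpen_ne_fun (by fun_prop) continuous_const

/-- `rep` is an arbitrary choice without continuity, but `(m ⬝ᵥ v)⁻¹ • v` is invariant under scaling
of `v` and so descends to the quotient. -/
theorem continuousAt_normRep {m : Fin 3 → ℝ} {p : RP2} (hp : m ⬝ᵥ p.rep ≠ 0) :
    ContinuousAt (normRep m) p := by
  have ho := isOpen_dotProduct_rep_ne_zero m
  refine ContinuousOn.continuousAt (s := {p : RP2 | m ⬝ᵥ p.rep ≠ 0}) ?_ (ho.mem_nhds hp)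
  rw [(isQuotientMap_projectivization_mk' ℝ (Fin 3 → ℝ)).continuousOn_isOpen_iff ho]
  have hg : ContinuousOn (fun v : {v : Fin 3 → ℝ // v ≠ 0} => (m ⬝ᵥ v.1)⁻¹ • v.1)
      (Projectivization.mk' ℝ ⁻¹' {p : RP2 | m ⬝ᵥ p.rep ≠ 0}) := by
    have hc : Continuous fun v : {v : Fin 3 → ℝ // v ≠ 0} => m ⬝ᵥ v.1 := by fun_prop
    refine (hc.continuousOn.inv₀ ?_).smul continuous_subtype_val.continuousOn
    intro v hv h0
    obtain ⟨c, hc, h⟩ := exists_rep_mk_eq v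
    apply hv
    rw [h, dotProduct_smul, h0, smul_zero]
  refine hg.congr fun v hv => ?_
  obtain ⟨c, hc, h⟩ := exists_rep_mk_eq v
  simp only [Function.comp_apply, normRep, h, dotProduct_smul, smul_eq_mul, smul_smul, mul_inv]
  congr 1
  field_simp

theorem dotProduct_normRep (a m : Fin 3 → ℝ) (p : RP2) :
    a ⬝ᵥ normRep m p = (a ⬝ᵥ p.rep) / (m ⬝ᵥ p.rep) := by
  rw [normRep, dotProduct_smul, smul_eq_mul, div_eq_inv_mul]

theorem dotProduct_normRep_self {m : Fin 3 → ℝ} {p : RP2} (hp : m ⬝ᵥ p.rep ≠ 0) :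
    m ⬝ᵥ normRep m p = 1 := by
  rw [dotProduct_normRep, div_self hp]

/-- The exponent 6 is even, so the sign of the product does not depend on the representative. -/
theorem prod_dotProduct_normRep (L : Fin 6 → Fin 3 → ℝ) (m : Fin 3 → ℝ) (p : RP2) :
    ∏ i, L i ⬝ᵥ normRep m p = (∏ i, L i ⬝ᵥ p.rep) / (m ⬝ᵥ p.rep) ^ 6 := by
  simp only [dotProduct_normRep, Finset.prod_div_distrib, Finset.prod_const, Finset.card_univ,
    Fintype.card_fin]

/-! ### The sign of the product of the six forms along the curve -/

theorem complexForm_smul (a : Fin 3 → ℝ) (c : ℂ) (v : Fin 3 → ℂ) :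
    complexForm a (c • v) = c * complexForm a v := by
  rw [complexForm, dotProduct_smul, smul_eq_mul, complexForm]

theorem complexForm_add (a : Fin 3 → ℝ) (v w : Fin 3 → ℂ) :
    complexForm a (v + w) = complexForm a v + complexForm a w := by
  rw [complexForm, dotProduct_add, complexForm, complexForm]

theorem complexForm_toC (a v : Fin 3 → ℝ) : complexForm a (toC v) = ((a ⬝ᵥ v : ℝ) : ℂ) := by
  simp [complexForm, toC, dotProduct]

theorem continuous_complexForm (a : Fin 3 → ℝ) : Continuous (complexForm a) := by
  unfold complexForm
  fun_prop

theorem mk_mem_complexLine {a : Fin 3 → ℝ} {v : Fin 3 → ℂ} (hv : v ≠ 0)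
    (h : complexForm a v = 0) : Projectivization.mk ℂ v hv ∈ complexLine a := by
  obtain ⟨c, hc⟩ := Projectivization.exists_smul_eq_mk_rep ℂ v hv
  change complexForm a (Projectivization.mk ℂ v hv).rep = 0
  rw [← hc, Units.smul_def, complexForm_smul, h, mul_zero]

theorem NoThreeConcurrent.eq_of_dotProduct_eq_zero {L : Fin 6 → Fin 3 → ℝ}
    (hL : NoThreeConcurrent L) {v : Fin 3 → ℝ} (hv : v ≠ 0) {i j k : Fin 6} (hij : i ≠ j)
    (hi : L i ⬝ᵥ v = 0) (hj : L j ⬝ᵥ v = 0) (hk : L k ⬝ᵥ v = 0) : k = i ∨ k = j := by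
  by_contra! hne
  have hz : ∀ {a : Fin 3 → ℝ}, a ⬝ᵥ v = 0 →
      Projectivization.mk ℂ (toC v) (toC_ne_zero hv) ∈ complexLine a := fun h =>
    mk_mem_complexLine _ (by rw [complexForm_toC, h, Complex.ofReal_zero])
  have := hL.2 i j k hij hne.1.symm hne.2.symm
  exact (Set.eq_empty_iff_forall_notMem.1 this _) ⟨⟨hz hi, hz hj⟩, hz hk⟩

/-- A continuous function keeps its sign near a point where it does not vanish. -/
theorem ContinuousAt.exists_sign {X : Type*} [TopologicalSpace X] {f : X → ℝ} {x : X}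
    (hf : ContinuousAt f x) (h : f x ≠ 0) :
    ∃ ε : ℝ, (ε = 1 ∨ ε = -1) ∧ ∀ᶠ y in 𝓝 x, 0 < ε * f y := by
  rcases h.lt_or_gt with h | h
  · refine ⟨-1, Or.inr rfl, ?_⟩
    filter_upwards [hf.eventually (gt_mem_nhds h)] with y hy
    linarith
  · refine ⟨1, Or.inl rfl, ?_⟩
    filter_upwards [hf.eventually (lt_mem_nhds h)] with y hy
    linarith

theorem sign_mul_sign {ε δ : ℝ} (hε : ε = 1 ∨ ε = -1) (hδ : δ = 1 ∨ δ = -1) :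
    ε * δ = 1 ∨ ε * δ = -1 := by
  rcases hε with rfl | rfl <;> rcases hδ with rfl | rfl <;> simp

theorem tendsto_sub_nhdsNE (t : ℝ) :
    Tendsto (fun s => s - t) (𝓝[>] t) (𝓝[>] 0) ∧ Tendsto (fun s => s - t) (𝓝[<] t) (𝓝[<] 0) := by
  have hc : Tendsto (fun s => s - t) (𝓝 t) (𝓝 0) := by
    have : Continuous fun s : ℝ => s - t := by fun_prop
    simpa using this.tendsto t
  constructor
  · refine tendsto_nhdsWithin_iff.2 ⟨hc.mono_left nhdsWithin_le_nhds, ?_⟩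
    filter_upwards [self_mem_nhdsWithin] with s hs
    exact sub_pos.2 (mem_Ioi.1 hs)
  · refine tendsto_nhdsWithin_iff.2 ⟨hc.mono_left nhdsWithin_le_nhds, ?_⟩
    filter_upwards [self_mem_nhdsWithin] with s hs
    exact sub_neg.2 (mem_Iio.1 hs)

variable {L : Fin 6 → Fin 3 → ℝ} {γ : AddCircle (1 : ℝ) → RP2}

/-- A crossing, seen in an arbitrary affine chart around the point. -/
theorem CrossesAt.exists_sign (hγ : Continuous γ) {a m : Fin 3 → ℝ} {t : ℝ}
    (h : CrossesAt a γ (t : AddCircle (1 : ℝ))) (hm : m ⬝ᵥ (γ t).rep ≠ 0) :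
    ∃ ε : ℝ, (ε = 1 ∨ ε = -1) ∧ (∀ᶠ s : ℝ in 𝓝[>] t, 0 < ε * (a ⬝ᵥ normRep m (γ s))) ∧
      (∀ᶠ s : ℝ in 𝓝[<] t, ε * (a ⬝ᵥ normRep m (γ s)) < 0) := by
  obtain ⟨n, hn, ε, hε, hr, hl⟩ := h
  have hcont : ContinuousAt (fun s : ℝ => n ⬝ᵥ normRep m (γ s)) t := by
    have h1 : ContinuousAt (fun s : ℝ => normRep m (γ s)) t :=
      ContinuousAt.comp (f := fun s : ℝ => γ s) (continuousAt_normRep hm)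
        (hγ.comp (AddCircle.continuous_mk' 1)).continuousAt
    fun_prop
  -- `δ` is the sign of `n / m` near `t`; passing from the denominator `n` to `m` multiplies by a
  -- function of this constant sign.
  obtain ⟨δ, hδ, hpos⟩ := hcont.exists_sign (by rw [dotProduct_normRep]; exact div_ne_zero hn hm)
  have hid : ∀ s : ℝ, t + (s - t) = s := fun s => by ring
  have key : ∀ s : ℝ, 0 < δ * (n ⬝ᵥ normRep m (γ s)) →
      ε * δ * (a ⬝ᵥ normRep m (γ s)) =
        (ε * ((a ⬝ᵥ (γ s).rep) / (n ⬝ᵥ (γ s).rep))) * (δ * (n ⬝ᵥ normRep m (γ s))) := by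
    intro s hs
    have hne : n ⬝ᵥ (γ s).rep ≠ 0 := by
      intro h0
      rw [dotProduct_normRep, h0] at hs
      simp at hs
    rw [dotProduct_normRep, dotProduct_normRep]
    field_simp
  refine ⟨ε * δ, sign_mul_sign hε hδ, ?_, ?_⟩
  · filter_upwards [(tendsto_sub_nhdsNE t).1.eventually hr, nhdsWithin_le_nhds hpos] with s h1 h2
    rw [← AddCircle.coe_add, hid] at h1
    rw [key s h2]
    exact mul_pos h1 h2
  · filter_upwards [(tendsto_sub_nhdsNE t).2.eventually hl, nhdsWithin_le_nhds hpos] with s h1 h2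
    rw [← AddCircle.coe_add, hid] at h1
    rw [key s h2]
    exact mul_neg_of_neg_of_pos h1 h2

/-- At a double point two factors change sign and the other four do not vanish, as no three lines
are concurrent; elsewhere continuity suffices. The product may vanish at `t` itself, whence the
punctured neighbourhood. -/
theorem IsAdmissibleCurve.exists_local_sign (hL : NoThreeConcurrent L)
    (hγ : IsAdmissibleCurve L γ) (t : ℝ) :
    ∃ ε : ℝ, (ε = 1 ∨ ε = -1) ∧ 0 ≤ ε * ∏ i, L i ⬝ᵥ (γ t).rep ∧
      ∀ᶠ s : ℝ in 𝓝[≠] t, 0 < ε * ∏ i, L i ⬝ᵥ (γ s).rep := by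
  -- The chart around `γ t` is given by the form that pairs with its representative; its value there
  -- is a sum of squares.
  set m := (γ t).rep with hmdef
  have hm : m ⬝ᵥ (γ t).rep ≠ 0 := by
    rw [← hmdef, Ne, dotProduct_self_eq_zero]
    exact (γ t).rep_nonzero
  have hcont (i : Fin 6) : ContinuousAt (fun s : ℝ => L i ⬝ᵥ normRep m (γ s)) t := by
    have h1 : ContinuousAt (fun s : ℝ => normRep m (γ s)) t :=
      ContinuousAt.comp (f := fun s : ℝ => γ s) (continuousAt_normRep hm)
        (hγ.continuous.comp (AddCircle.continuous_mk' 1)).continuousAt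
    fun_prop
  suffices h : ∃ ε : ℝ, (ε = 1 ∨ ε = -1) ∧ 0 ≤ ε * ∏ i, L i ⬝ᵥ (γ t).rep ∧
      ∀ᶠ s : ℝ in 𝓝[≠] t, 0 < ε * ∏ i, L i ⬝ᵥ normRep m (γ s) by
    obtain ⟨ε, hε, h1, h2⟩ := h
    refine ⟨ε, hε, h1, ?_⟩
    filter_upwards [h2] with s hs
    rw [prod_dotProduct_normRep] at hs
    have h0 : m ⬝ᵥ (γ s).rep ≠ 0 := by
      intro h0
      simp [h0] at hs
    have h6 : 0 < (m ⬝ᵥ (γ s).rep) ^ 6 := by positivity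
    rw [← mul_div_assoc] at hs
    exact (div_pos_iff_of_pos_right h6).1 hs
  by_cases hz : ∃ i, L i ⬝ᵥ (γ t).rep = 0
  · obtain ⟨i, hi⟩ := hz
    obtain ⟨j, hji, hj⟩ := hγ.double_point t i hi
    obtain ⟨δ, hδ, hδr, hδl⟩ := (hγ.crosses t i hi).exists_sign hγ.continuous hm
    obtain ⟨η, hη, hηr, hηl⟩ := (hγ.crosses t j hj).exists_sign hγ.continuous hm
    have hrest : ContinuousAt (fun s : ℝ =>
        ∏ k ∈ (Finset.univ.erase i).erase j, L k ⬝ᵥ normRep m (γ s)) t := by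
      refine tendsto_finsetProd _ fun k _ => hcont k
    obtain ⟨θ, hθ, hθpos⟩ := hrest.exists_sign (by
      refine Finset.prod_ne_zero_iff.2 fun k hk h0 => ?_
      rw [dotProduct_normRep, div_eq_zero_iff, or_iff_left hm] at h0
      rw [Finset.mem_erase, Finset.mem_erase] at hk
      rcases hL.eq_of_dotProduct_eq_zero (γ t).rep_nonzero hji.symm hi hj h0 with h | h
      · exact hk.2.1 h
      · exact hk.1 h)
    have hsplit (s : ℝ) : ∏ k, L k ⬝ᵥ normRep m (γ s) = (L i ⬝ᵥ normRep m (γ s)) *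
        ((L j ⬝ᵥ normRep m (γ s)) *
          ∏ k ∈ (Finset.univ.erase i).erase j, L k ⬝ᵥ normRep m (γ s)) := by
      rw [Finset.mul_prod_erase _ (fun k => L k ⬝ᵥ normRep m (γ s))
          (Finset.mem_erase.2 ⟨hji, Finset.mem_univ _⟩),
        Finset.mul_prod_erase _ (fun k => L k ⬝ᵥ normRep m (γ s)) (Finset.mem_univ _)]
    refine ⟨δ * η * θ, sign_mul_sign (sign_mul_sign hδ hη) hθ, ?_, ?_⟩
    · rw [Finset.prod_eq_zero (Finset.mem_univ i) hi, mul_zero]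
    · rw [← Iio_union_Ioi, nhdsWithin_union, eventually_sup]
      constructor
      · filter_upwards [hδl, hηl, nhdsWithin_le_nhds hθpos] with s h1 h2 h3
        rw [hsplit]
        have := mul_pos (mul_pos_of_neg_of_neg h1 h2) h3
        linarith
      · filter_upwards [hδr, hηr, nhdsWithin_le_nhds hθpos] with s h1 h2 h3
        rw [hsplit]
        have := mul_pos (mul_pos h1 h2) h3
        linarith
  · push Not at hz
    have hall : ContinuousAt (fun s : ℝ => ∏ k, L k ⬝ᵥ normRep m (γ s)) t :=
      tendsto_finsetProd _ fun k _ => hcont k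
    obtain ⟨ε, hε, hpos⟩ := hall.exists_sign (by
      rw [prod_dotProduct_normRep]
      exact div_ne_zero (Finset.prod_ne_zero_iff.2 fun i _ => hz i) (pow_ne_zero _ hm))
    refine ⟨ε, hε, ?_, nhdsWithin_le_nhds hpos⟩
    have ht := hpos.self_of_nhds
    rw [prod_dotProduct_normRep, ← mul_div_assoc] at ht
    exact ((div_pos_iff_of_pos_right (by positivity)).1 ht).le

/-- As the curve crosses two lines at a time, the product of the six forms does not change its
sign. -/
theorem IsAdmissibleCurve.exists_sign (hL : NoThreeConcurrent L) (hγ : IsAdmissibleCurve L γ) :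
    ∃ ε : ℝ, (ε = 1 ∨ ε = -1) ∧ ∀ t, 0 ≤ ε * ∏ i, L i ⬝ᵥ (γ t).rep := by
  choose e he h0 hpos using hγ.exists_local_sign hL
  have hconst : IsLocallyConstant e := by
    rw [IsLocallyConstant.iff_eventually_eq]
    intro t
    have h1 := eventually_eventually_nhdsWithin.2 (hpos t)
    rw [eventually_nhdsWithin_iff] at h1
    filter_upwards [h1] with s hs
    rcases eq_or_ne s t with rfl | hst
    · rfl
    · have h2 : ∀ᶠ r : ℝ in 𝓝[≠] s, 0 < e t * ∏ i, L i ⬝ᵥ (γ r).rep := by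
        have h3 := hs hst
        rw [nhdsWithin_eq_nhds.2 (isOpen_compl_singleton.mem_nhds hst)] at h3
        exact nhdsWithin_le_nhds h3
      -- Close to `s` there is a parameter `r ≠ s` at which the strict inequalities for `e t` and
      -- for `e s` both hold.
      obtain ⟨r, hr1, hr2⟩ := (h2.and (hpos s)).exists
      rcases he t with ht | ht <;> rcases he s with hs' | hs' <;> rw [ht] at hr1 ⊢ <;>
        rw [hs'] at hr2 ⊢ <;> linarith
  refine ⟨e 0, he 0, fun t => ?_⟩
  obtain ⟨s, rfl⟩ := QuotientAddGroup.mk_surjective t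
  rw [hconst.apply_eq_of_preconnectedSpace 0 s]
  exact h0 s

end

noncomputable section

/-! ### The forms on the complexified chart -/

/-- The coefficient vector of the form that defines the line at infinity. -/
def infinityRow (C : GL (Fin 3) ℝ) : Fin 3 → ℝ := (C⁻¹).1 2

theorem infinityForm_eq (C : GL (Fin 3) ℝ) (v : Fin 3 → ℝ) :
    infinityForm C v = infinityRow C ⬝ᵥ v := rfl

theorem infinityForm_directionVec (C : GL (Fin 3) ℝ) (b : Fin 2 → ℝ) :
    infinityForm C (directionVec C b) = 0 := by
  rw [infinityForm, directionVec, GL_inv_mulVec]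
  simp

/-- The value of the form `L i` at the direction `b`. -/
def formSlope (L : Fin 6 → Fin 3 → ℝ) (C : GL (Fin 3) ℝ) (b : Fin 2 → ℝ) (i : Fin 6) : ℝ :=
  L i ⬝ᵥ directionVec C b

theorem dotProduct_eq_affineCoeffs (C : GL (Fin 3) ℝ) (a v : Fin 3 → ℝ) :
    a ⬝ᵥ (C.1 *ᵥ v) = affineCoeffs C a 0 * v 0 + affineCoeffs C a 1 * v 1 +
      affineCoeffs C a 2 * v 2 := by
  rw [dotProduct_mulVec, dotProduct, Fin.sum_univ_three, affineCoeffs]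

/-- `A₁ b₁ + A₂ b₂ = 0` puts `b` on the span of `(A₂, -A₁)` unless `A₁ = A₂ = 0`. In that case `L i`
is a multiple of the form at infinity, which is impossible for a line that meets the chart. -/
theorem formSlope_ne_zero {L : Fin 6 → Fin 3 → ℝ} (hL : NoThreeConcurrent L)
    {C : GL (Fin 3) ℝ} (hC : ∀ i, ChartMeets C (L i)) {b : Fin 2 → ℝ}
    (hb : b ∉ exceptionalSet C L) (i : Fin 6) : formSlope L C b i ≠ 0 := by
  intro h
  rw [formSlope, directionVec, dotProduct_eq_affineCoeffs] at h
  simp only [Matrix.cons_val, mul_zero, add_zero] at h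
  set A := affineCoeffs C (L i) with hA
  have hspan (c : ℝ) (h0 : c * A 1 = b 0) (h1 : c * -A 0 = b 1) : False := by
    apply hb
    refine Set.mem_iUnion.2 ⟨i, Submodule.mem_span_singleton.2 ⟨c, ?_⟩⟩
    funext k
    fin_cases k
    · simpa using h0
    · simpa using h1
  by_cases h1 : A 1 = 0
  · by_cases h0 : A 0 = 0
    · have hinv (v : Fin 3 → ℝ) : C.1 *ᵥ ((C⁻¹).1 *ᵥ v) = v := by
        rw [Matrix.mulVec_mulVec, ← Units.val_mul, mul_inv_cancel, Units.val_one,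
          Matrix.one_mulVec]
      have hform (v : Fin 3 → ℝ) : L i ⬝ᵥ v = A 2 * infinityForm C v := by
        conv_lhs => rw [← hinv v, dotProduct_eq_affineCoeffs, ← hA, h0, h1]
        rw [infinityForm]
        ring
      obtain ⟨p, hp, hpC⟩ := hC i
      have hp0 : L i ⬝ᵥ p.rep = 0 := hp
      rw [hform, mul_eq_zero, or_iff_left (show infinityForm C p.rep ≠ 0 from hpC)] at hp0
      apply hL.1 i
      rw [← dotProduct_self_eq_zero, hform, hp0, zero_mul]
    · rw [h1] at h
      have hb0 : b 0 = 0 := by simpa [h0] using h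
      refine hspan (-(b 1 / A 0)) (by rw [h1, hb0, mul_zero]) ?_
      field_simp
  · refine hspan (b 0 / A 1) (by field_simp) ?_
    field_simp
    linarith

theorem complexForm_spheroidVec (C : GL (Fin 3) ℝ) (b : Fin 2 → ℝ) (a v : Fin 3 → ℝ) (u : ℝ) :
    complexForm a (spheroidVec C b v u) = ((a ⬝ᵥ v : ℝ) : ℂ) +
      Complex.I * u * (infinityForm C v : ℂ) * ((a ⬝ᵥ directionVec C b : ℝ) : ℂ) := by
  rw [spheroidVec, complexForm_add, complexForm_smul, complexForm_toC, complexForm_toC]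

theorem toC_smul {n : ℕ} (c : ℝ) (v : Fin n → ℝ) : toC (c • v) = (c : ℂ) • toC v := by
  funext k
  simp [toC]

theorem toC_sub {n : ℕ} (v w : Fin n → ℝ) : toC (v - w) = toC v - toC w := by
  funext k
  simp [toC]

theorem continuous_toC {n : ℕ} : Continuous (toC : (Fin n → ℝ) → Fin n → ℂ) := by
  unfold toC
  fun_prop

theorem spheroidVec_smul (C : GL (Fin 3) ℝ) (b : Fin 2 → ℝ) (c : ℝ) (v : Fin 3 → ℝ) (u : ℝ) :
    spheroidVec C b (c • v) u = (c : ℂ) • spheroidVec C b v u := by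
  rw [spheroidVec, spheroidVec, infinityForm_eq, infinityForm_eq, dotProduct_smul, toC_smul,
    smul_add, smul_smul, smul_eq_mul]
  congr 2
  push_cast
  ring

/-- The value at `p`, a point of the affine chart, of the affine form `L i / L i (b)`. -/
def slopeCoord (L : Fin 6 → Fin 3 → ℝ) (C : GL (Fin 3) ℝ) (b : Fin 2 → ℝ) (i : Fin 6)
    (p : RP2) : ℝ :=
  (L i ⬝ᵥ normRep (infinityRow C) p) / formSlope L C b i

theorem continuousAt_slopeCoord (L : Fin 6 → Fin 3 → ℝ) {C : GL (Fin 3) ℝ} (b : Fin 2 → ℝ)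
    (i : Fin 6) {p : RP2} (hp : ¬ AtInfinity C p) : ContinuousAt (slopeCoord L C b i) p := by
  have := continuousAt_normRep (m := infinityRow C) (p := p) hp
  unfold slopeCoord
  fun_prop

theorem prod_slopeCoord (L : Fin 6 → Fin 3 → ℝ) (C : GL (Fin 3) ℝ) (b : Fin 2 → ℝ) (p : RP2) :
    ∏ i, slopeCoord L C b i p =
      (∏ i, L i ⬝ᵥ p.rep) / (infinityForm C p.rep) ^ 6 / ∏ i, formSlope L C b i := by
  simp only [slopeCoord, Finset.prod_div_distrib, prod_dotProduct_normRep, infinityForm_eq]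

theorem exists_rep_eq_smul_directionVec {C : GL (Fin 3) ℝ} {b : Fin 2 → ℝ} {hb : b ≠ 0} {p : RP2}
    (hp : p = directionPoint C hb) : ∃ c : ℝ, c ≠ 0 ∧ p.rep = c • directionVec C b := by
  obtain ⟨c, hc⟩ := Projectivization.exists_smul_eq_mk_rep ℝ (directionVec C b)
    (directionVec_ne_zero C hb)
  refine ⟨c, c.ne_zero, ?_⟩
  rw [hp]
  exact hc.symm

/-- The divisors are a sixth power and the constant `∏ L i (b)`. Where `γ` is at infinity its
representative is `c` times the direction vector, so `∏ L i` equals `c ^ 6 * ∏ L i (b)`; the two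
signs `δ` and `η` then coincide. -/
theorem IsAdmissibleCurve.exists_slopeCoord_sign {L : Fin 6 → Fin 3 → ℝ}
    {γ : AddCircle (1 : ℝ) → RP2} (hL : NoThreeConcurrent L) (hγ : IsAdmissibleCurve L γ)
    {C : GL (Fin 3) ℝ} {b : Fin 2 → ℝ} {hb : b ≠ 0} (hs : ∀ i, formSlope L C b i ≠ 0)
    (hinf : ∀ t, AtInfinity C (γ t) → γ t = directionPoint C hb) :
    ∃ ε : ℝ, (ε = 1 ∨ ε = -1) ∧ (∀ t, 0 ≤ ε * ∏ i, slopeCoord L C b i (γ t)) ∧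
      ∀ t, AtInfinity C (γ t) → ε = 1 := by
  obtain ⟨δ, hδ, hpos⟩ := hγ.exists_sign hL
  have hne : ∏ i, formSlope L C b i ≠ 0 := Finset.prod_ne_zero_iff.2 fun i _ => hs i
  obtain ⟨η, hη, hηpos⟩ : ∃ η : ℝ, (η = 1 ∨ η = -1) ∧ 0 < η * ∏ i, formSlope L C b i := by
    rcases hne.lt_or_gt with h | h
    · exact ⟨-1, Or.inr rfl, by linarith⟩
    · exact ⟨1, Or.inl rfl, by linarith⟩
  refine ⟨δ * η, sign_mul_sign hδ hη, fun t => ?_, fun t ht => ?_⟩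
  -- At infinity both sides are 0, by the convention for division by zero.
  · have h : δ * η * ∏ i, slopeCoord L C b i (γ t) = (δ * ∏ i, L i ⬝ᵥ (γ t).rep) /
        (infinityForm C (γ t).rep ^ 6) / (η * ∏ i, formSlope L C b i) := by
      rw [prod_slopeCoord]
      rcases hη with rfl | rfl
      · rw [one_mul, mul_one, mul_div_assoc, mul_div_assoc]
      · rw [neg_one_mul, div_neg]
        ring
    rw [h]
    exact div_nonneg (div_nonneg (hpos t) (by positivity)) hηpos.le
  · obtain ⟨c, hc, hrep⟩ := exists_rep_eq_smul_directionVec (hinf t ht)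
    have h := hpos t
    have hprod : ∏ i, L i ⬝ᵥ (γ t).rep = c ^ 6 * ∏ i, formSlope L C b i := by
      simp only [hrep, dotProduct_smul, smul_eq_mul, Finset.prod_mul_distrib, Finset.prod_const,
        Finset.card_univ, Fintype.card_fin, formSlope]
    have hc6 : 0 < c ^ 6 := by positivity
    rw [hprod] at h
    have h1 := mul_pos hc6 hηpos
    rcases hδ with rfl | rfl <;> rcases hη with rfl | rfl <;> first | (norm_num; done) | linarith

/-! ### The lift of the spheroid -/

theorem continuous_coverMap (L : Fin 6 → Fin 3 → ℝ) : Continuous (coverMap L) := by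
  refine Continuous.quotient_lift (f := fun p : DoubleCoverCone L =>
    Projectivization.mk ℂ p.1.1 p.2.1) ?_ _
  exact (isQuotientMap_projectivization_mk' ℂ (Fin 3 → ℂ)).continuous.comp
    ((continuous_fst.comp continuous_subtype_val).subtype_mk fun p : DoubleCoverCone L => p.2.1)

/-- Continuity of a map to the double cover may be checked after rescaling. -/
theorem continuousAt_doubleCover_mk {X : Type*} [TopologicalSpace X] {L : Fin 6 → Fin 3 → ℝ}
    (f : X → DoubleCoverCone L) (c : X → ℂ) (hc : ∀ x, c x ≠ 0) {x : X}
    (h1 : ContinuousAt (fun y => c y • (f y).1.1) x)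
    (h2 : ContinuousAt (fun y => c y ^ 3 * (f y).1.2) x) :
    ContinuousAt (fun y => (Quotient.mk (doubleCoverSetoid L) (f y) : DoubleCover L)) x := by
  have hg (y : X) : c y • (f y).1.1 ≠ 0 ∧
      (c y ^ 3 * (f y).1.2) ^ 2 = ∏ i, complexForm (L i) (c y • (f y).1.1) := by
    refine ⟨smul_ne_zero (hc y) (f y).2.1, ?_⟩
    simp only [complexForm_smul, Finset.prod_mul_distrib, Finset.prod_const, Finset.card_univ,
      Fintype.card_fin, ← (f y).2.2]
    ring
  let g : X → DoubleCoverCone L := fun y => ⟨(c y • (f y).1.1, c y ^ 3 * (f y).1.2), hg y⟩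
  have hfg : (fun y => (Quotient.mk (doubleCoverSetoid L) (f y) : DoubleCover L)) =
      fun y => Quotient.mk (doubleCoverSetoid L) (g y) :=
    funext fun y => Quotient.sound ⟨c y, hc y, rfl, rfl⟩
  rw [hfg]
  have hq : Continuous (Quotient.mk (doubleCoverSetoid L) : DoubleCoverCone L → DoubleCover L) :=
    continuous_quotient_mk'
  have hi : IsInducing (Subtype.val : DoubleCoverCone L → (Fin 3 → ℂ) × ℂ) := IsInducing.subtypeVal
  exact hq.continuousAt.comp (f := g) (hi.continuousAt_iff.2 (h1.prodMk h2))

/-- The parameters that the spheroid sends to the point at infinity in the given direction. -/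
def IsInfiniteParam (C : GL (Fin 3) ℝ) (γ : AddCircle (1 : ℝ) → RP2)
    (p : AddCircle (1 : ℝ) × EReal) : Prop :=
  p.2 = ⊤ ∨ p.2 = ⊥ ∨ AtInfinity C (γ p.1)

/-- The value at the point `γ t + i u b` of the affine form `L i / L i (b)`. -/
def complexCoord (L : Fin 6 → Fin 3 → ℝ) (C : GL (Fin 3) ℝ) (b : Fin 2 → ℝ)
    (γ : AddCircle (1 : ℝ) → RP2) (i : Fin 6) (p : AddCircle (1 : ℝ) × EReal) : ℂ :=
  slopeCoord L C b i (γ p.1) + p.2.toReal * Complex.I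

/-- The sign by which the choice of the square root differs on the two hemispheres. -/
def hemisphereSign (ε : ℝ) (u : EReal) : ℂ := if 0 ≤ u then 1 else ε

open Classical in
/-- The coordinates `v` of a point on the cone over the lift of the spheroid. -/
def liftVec (C : GL (Fin 3) ℝ) (b : Fin 2 → ℝ) (γ : AddCircle (1 : ℝ) → RP2)
    (p : AddCircle (1 : ℝ) × EReal) : Fin 3 → ℂ :=
  if IsInfiniteParam C γ p then toC (directionVec C b)
  else spheroidVec C b (normRep (infinityRow C) (γ p.1)) p.2.toReal

open Classical in
/-- The coordinate `w` of a point on the cone over the lift of the spheroid. -/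
def liftRoot (L : Fin 6 → Fin 3 → ℝ) (C : GL (Fin 3) ℝ) (b : Fin 2 → ℝ)
    (γ : AddCircle (1 : ℝ) → RP2) (κ : ℂ) (ε : ℝ) (p : AddCircle (1 : ℝ) × EReal) : ℂ :=
  κ * (hemisphereSign ε p.2 *
    if IsInfiniteParam C γ p then 1 else ∏ i, halfSqrt (complexCoord L C b γ i p))

variable {L : Fin 6 → Fin 3 → ℝ} {C : GL (Fin 3) ℝ} {b : Fin 2 → ℝ}
  {γ : AddCircle (1 : ℝ) → RP2} {κ : ℂ} {ε : ℝ}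

theorem infinityForm_normRep {p : RP2} (hp : ¬ AtInfinity C p) :
    infinityForm C (normRep (infinityRow C) p) = 1 :=
  dotProduct_normRep_self (m := infinityRow C) hp

/-- With the form at infinity normalised to 1, moving by `i u b` adds `i u L i (b)` to the form `L
i`. -/
theorem complexForm_liftVec_of_not {i : Fin 6} (hs : formSlope L C b i ≠ 0)
    {p : AddCircle (1 : ℝ) × EReal} (hp : ¬ IsInfiniteParam C γ p) :
    complexForm (L i) (liftVec C b γ p) = formSlope L C b i * complexCoord L C b γ i p := by
  have hs' : (formSlope L C b i : ℂ) ≠ 0 := Complex.ofReal_ne_zero.2 hs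
  rw [liftVec, if_neg hp, complexForm_spheroidVec,
    infinityForm_normRep fun h => hp (Or.inr (Or.inr h)), complexCoord, slopeCoord,
    ← formSlope]
  push_cast
  field_simp

theorem complexForm_directionVec (i : Fin 6) :
    complexForm (L i) (toC (directionVec C b)) = formSlope L C b i := by
  rw [complexForm_toC, formSlope]

theorem liftVec_ne_zero (hb : b ≠ 0) (p : AddCircle (1 : ℝ) × EReal) : liftVec C b γ p ≠ 0 := by
  unfold liftVec
  split_ifs with h
  · exact toC_ne_zero (directionVec_ne_zero C hb)
  · refine spheroidVec_ne_zero C b (fun h0 => ?_) _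
    have h1 := infinityForm_normRep fun h' => h (Or.inr (Or.inr h'))
    rw [h0, infinityForm_eq, dotProduct_zero] at h1
    exact zero_ne_one h1

theorem hemisphereSign_sq (hε : ε = 1 ∨ ε = -1) (u : EReal) : hemisphereSign ε u ^ 2 = 1 := by
  unfold hemisphereSign
  split_ifs
  · exact one_pow 2
  · rcases hε with rfl | rfl <;> norm_num

theorem liftRoot_sq (hs : ∀ i, formSlope L C b i ≠ 0) (hκ : κ ^ 2 = ∏ i, (formSlope L C b i : ℂ))
    (hε : ε = 1 ∨ ε = -1) (p : AddCircle (1 : ℝ) × EReal) :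
    liftRoot L C b γ κ ε p ^ 2 = ∏ i, complexForm (L i) (liftVec C b γ p) := by
  rw [liftRoot, mul_pow, mul_pow, hemisphereSign_sq hε, one_mul, hκ]
  by_cases h : IsInfiniteParam C γ p
  · simp only [if_pos h, liftVec, complexForm_directionVec, one_pow, mul_one]
  · simp only [complexForm_liftVec_of_not (hs _) h, if_neg h, ← Finset.prod_pow, halfSqrt_sq,
      Finset.prod_mul_distrib]

/-! ### Continuity of the lift at finite parameters -/

theorem eventually_not_isInfiniteParam (hγ : Continuous γ) {p : AddCircle (1 : ℝ) × EReal}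
    (hp : ¬ IsInfiniteParam C γ p) : ∀ᶠ q in 𝓝 p, ¬ IsInfiniteParam C γ q := by
  simp only [IsInfiniteParam, not_or] at hp ⊢
  have hc : Continuous fun q : AddCircle (1 : ℝ) × EReal => γ q.1 := hγ.comp continuous_fst
  have ho : ∀ᶠ q in 𝓝 p, ¬ AtInfinity C (γ q.1) :=
    ((isOpen_dotProduct_rep_ne_zero (infinityRow C)).preimage hc).mem_nhds hp.2.2
  filter_upwards [continuousAt_snd.eventually_ne hp.1, continuousAt_snd.eventually_ne hp.2.1,
    ho] with q h1 h2 h3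
  exact ⟨h1, h2, h3⟩

theorem continuousAt_toReal_snd {p : AddCircle (1 : ℝ) × EReal} (hp : ¬ IsInfiniteParam C γ p) :
    ContinuousAt (fun q : AddCircle (1 : ℝ) × EReal => q.2.toReal) p := by
  simp only [IsInfiniteParam, not_or] at hp
  exact (EReal.tendsto_toReal hp.1 hp.2.1).comp continuousAt_snd

theorem continuousAt_complexCoord (hγ : Continuous γ) (i : Fin 6)
    {p : AddCircle (1 : ℝ) × EReal} (hp : ¬ IsInfiniteParam C γ p) :
    ContinuousAt (complexCoord L C b γ i) p := by
  have h1 : ContinuousAt (fun q : AddCircle (1 : ℝ) × EReal => slopeCoord L C b i (γ q.1)) p :=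
    ContinuousAt.comp (f := fun q : AddCircle (1 : ℝ) × EReal => γ q.1)
      (continuousAt_slopeCoord L b i fun h => hp (Or.inr (Or.inr h)))
      (hγ.comp continuous_fst).continuousAt
  have h2 := continuousAt_toReal_snd hp
  unfold complexCoord
  exact (Complex.continuous_ofReal.continuousAt.comp h1).add
    ((Complex.continuous_ofReal.continuousAt.comp h2).mul continuousAt_const)

theorem continuousAt_liftVec (hγ : Continuous γ) {p : AddCircle (1 : ℝ) × EReal}
    (hp : ¬ IsInfiniteParam C γ p) : ContinuousAt (liftVec C b γ) p := by
  have h1 : ContinuousAt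
      (fun q : AddCircle (1 : ℝ) × EReal => normRep (infinityRow C) (γ q.1)) p :=
    ContinuousAt.comp (f := fun q : AddCircle (1 : ℝ) × EReal => γ q.1)
      (continuousAt_normRep fun h => hp (Or.inr (Or.inr h)))
      (hγ.comp continuous_fst).continuousAt
  have h2 := continuousAt_toReal_snd hp
  have h3 : ContinuousAt (fun q : AddCircle (1 : ℝ) × EReal =>
      spheroidVec C b (normRep (infinityRow C) (γ q.1)) q.2.toReal) p := by
    have hc : Continuous fun r : (Fin 3 → ℝ) × ℝ => spheroidVec C b r.1 r.2 := by
      unfold spheroidVec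
      simp only [infinityForm_eq]
      have h : Continuous fun r : (Fin 3 → ℝ) × ℝ =>
          Complex.I * (r.2 : ℂ) * ((infinityRow C ⬝ᵥ r.1 : ℝ) : ℂ) := by fun_prop
      exact (continuous_toC.comp continuous_fst).add (h.smul continuous_const)
    exact hc.continuousAt.comp (h1.prodMk h2)
  refine h3.congr ?_
  filter_upwards [eventually_not_isInfiniteParam hγ hp] with q hq
  rw [liftVec, if_neg hq]

theorem complexCoord_im (i : Fin 6) (p : AddCircle (1 : ℝ) × EReal) :
    (complexCoord L C b γ i p).im = p.2.toReal := by
  simp [complexCoord]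

theorem complexCoord_re (i : Fin 6) (p : AddCircle (1 : ℝ) × EReal) :
    (complexCoord L C b γ i p).re = slopeCoord L C b i (γ p.1) := by
  simp [complexCoord]

/-- The root from above and the signed root from below are both continuous at every finite
parameter, and at `u = 0` they agree by the sign condition, so they can be glued there. -/
theorem continuousAt_liftRoot (hγ : Continuous γ) (hε : ε = 1 ∨ ε = -1)
    (hsign : ∀ t, 0 ≤ ε * ∏ i, slopeCoord L C b i (γ t)) {p : AddCircle (1 : ℝ) × EReal}
    (hp : ¬ IsInfiniteParam C γ p) : ContinuousAt (liftRoot L C b γ κ ε) p := by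
  set f : AddCircle (1 : ℝ) × EReal → ℂ := fun q => ∏ i, upperSqrt (complexCoord L C b γ i q)
    with hf
  set g : AddCircle (1 : ℝ) × EReal → ℂ := fun q =>
    ε * ∏ i, starRingEnd ℂ (upperSqrt (complexCoord L C b γ i q)) with hg
  have hsqrt (i : Fin 6) : ContinuousAt (fun q => upperSqrt (complexCoord L C b γ i q)) p :=
    continuous_upperSqrt.continuousAt.comp (continuousAt_complexCoord hγ i hp)
  have hfc : ContinuousAt f p := tendsto_finsetProd _ fun i _ => hsqrt i
  have hgc : ContinuousAt g p := continuousAt_const.mul (tendsto_finsetProd _ fun i _ =>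
    (Complex.continuous_conj.continuousAt.comp (hsqrt i) :
      ContinuousAt (fun q => starRingEnd ℂ (upperSqrt (complexCoord L C b γ i q))) p))
  have hlift : ∀ᶠ q in 𝓝 p, (if 0 ≤ q.2 then f q else g q) = hemisphereSign ε q.2 *
      ∏ i, halfSqrt (complexCoord L C b γ i q) := by
    filter_upwards [eventually_not_isInfiniteParam hγ hp] with q hq
    simp only [IsInfiniteParam, not_or] at hq
    have hiff : 0 ≤ q.2 ↔ 0 ≤ q.2.toReal := by
      rw [← EReal.coe_nonneg, EReal.coe_toReal hq.1 hq.2.1]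
    simp only [halfSqrt, complexCoord_im, ← hiff, hemisphereSign]
    split_ifs
    · rw [one_mul]
    · rfl
  have hmain : ContinuousAt (fun q => if 0 ≤ q.2 then f q else g q) p := by
    rcases lt_trichotomy p.2 0 with h | h | h
    · refine hgc.congr ?_
      filter_upwards [continuousAt_snd.eventually (gt_mem_nhds h)] with q hq
      rw [if_neg (not_le.2 hq)]
    · have hfg : g p = f p := by
        have h0 (i : Fin 6) : complexCoord L C b γ i p = (slopeCoord L C b i (γ p.1) : ℂ) := by
          simp [complexCoord, h]
        simp only [hf, hg, h0]
        exact prod_upperSqrt_ofReal _ _ hε (hsign p.1)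
      rw [ContinuousAt, if_pos h.ge]
      exact Tendsto.if' hfc (hfg ▸ hgc.tendsto)
    · refine hfc.congr ?_
      filter_upwards [continuousAt_snd.eventually (lt_mem_nhds h)] with q hq
      rw [if_pos hq.le]
  refine ((continuousAt_const (y := κ)).mul (hmain.congr hlift)).congr ?_
  filter_upwards [eventually_not_isInfiniteParam hγ hp] with q hq
  rw [liftRoot, if_neg hq, Pi.mul_apply]

/-! ### Continuity of the lift over the point at infinity -/

open Classical in
/-- The scaling factor that normalises the form `L 0 / L 0 (b)` to the value `1`. -/
def liftScale (L : Fin 6 → Fin 3 → ℝ) (C : GL (Fin 3) ℝ) (b : Fin 2 → ℝ)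
    (γ : AddCircle (1 : ℝ) → RP2) (p : AddCircle (1 : ℝ) × EReal) : ℂ :=
  if IsInfiniteParam C γ p ∨ complexCoord L C b γ 0 p = 0 then 1
  else (complexCoord L C b γ 0 p)⁻¹

theorem liftScale_ne_zero (p : AddCircle (1 : ℝ) × EReal) : liftScale L C b γ p ≠ 0 := by
  unfold liftScale
  split_ifs with h
  · exact one_ne_zero
  · exact inv_ne_zero fun h0 => h (Or.inr h0)

/-- The representative of a point of the affine chart, without its component in direction `b`. -/
def slopeDefect (L : Fin 6 → Fin 3 → ℝ) (C : GL (Fin 3) ℝ) (b : Fin 2 → ℝ) (q : RP2) :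
    Fin 3 → ℝ :=
  normRep (infinityRow C) q - slopeCoord L C b 0 q • directionVec C b

/-- The vector is the defect plus `z_0` times the direction vector, and the defect does not depend
on `u`. -/
theorem inv_smul_liftVec_sub {p : AddCircle (1 : ℝ) × EReal} (hp : ¬ IsInfiniteParam C γ p)
    (h0 : complexCoord L C b γ 0 p ≠ 0) :
    (complexCoord L C b γ 0 p)⁻¹ • liftVec C b γ p - toC (directionVec C b) =
      (complexCoord L C b γ 0 p)⁻¹ • toC (slopeDefect L C b (γ p.1)) := by
  rw [liftVec, if_neg hp, spheroidVec, infinityForm_normRep fun h => hp (Or.inr (Or.inr h)),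
    slopeDefect, toC_sub, toC_smul]
  have h1 : toC (directionVec C b) = (complexCoord L C b γ 0 p)⁻¹ •
      complexCoord L C b γ 0 p • toC (directionVec C b) := by
    rw [smul_smul, inv_mul_cancel₀ h0, one_smul]
  nth_rewrite 2 [h1]
  rw [← smul_sub]
  congr 1
  funext k
  simp only [Pi.add_apply, Pi.sub_apply, Pi.smul_apply, smul_eq_mul, complexCoord]
  push_cast
  ring

/-- Near infinity the part of the point that does not lie in direction `b` is small. -/
def DefectSmallAt (L : Fin 6 → Fin 3 → ℝ) (C : GL (Fin 3) ℝ) (b : Fin 2 → ℝ)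
    (γ : AddCircle (1 : ℝ) → RP2) (p : AddCircle (1 : ℝ) × EReal) : Prop :=
  ∀ δ : ℝ, 0 < δ → ∀ᶠ q in 𝓝 p, ¬ IsInfiniteParam C γ q → complexCoord L C b γ 0 q ≠ 0 ∧
    ‖toC (slopeDefect L C b (γ q.1))‖ < δ * ‖complexCoord L C b γ 0 q‖

/-- The defect stays bounded near `p`, whereas `|z_0| ≥ |u|` tends to infinity. -/
theorem defectSmallAt_of_eq_top_or_bot (hγ : Continuous γ) {p : AddCircle (1 : ℝ) × EReal}
    (hp : ¬ AtInfinity C (γ p.1)) (hu : p.2 = ⊤ ∨ p.2 = ⊥) : DefectSmallAt L C b γ p := by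
  intro δ hδ
  have hc : ContinuousAt (fun q : AddCircle (1 : ℝ) × EReal =>
      ‖toC (slopeDefect L C b (γ q.1))‖) p := by
    have h1 : ContinuousAt (slopeDefect L C b) (γ p.1) :=
      (continuousAt_normRep hp).sub ((continuousAt_slopeCoord L b 0 hp).smul continuousAt_const)
    have h2 : ContinuousAt (fun q : AddCircle (1 : ℝ) × EReal => slopeDefect L C b (γ q.1)) p :=
      ContinuousAt.comp (f := fun q : AddCircle (1 : ℝ) × EReal => γ q.1) h1
        (hγ.comp continuous_fst).continuousAt
    exact (continuous_toC.continuousAt.comp h2).norm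
  set M := ‖toC (slopeDefect L C b (γ p.1))‖ + 1 with hM
  have hMpos : 0 < M := by positivity
  have hlarge : ∀ᶠ q in 𝓝 p, ((M / δ : ℝ) : EReal) < q.2 ∨ q.2 < ((-(M / δ) : ℝ) : EReal) := by
    rcases hu with hu | hu
    · have : ((M / δ : ℝ) : EReal) < p.2 := hu ▸ EReal.coe_lt_top _
      filter_upwards [continuousAt_snd.eventually (lt_mem_nhds this)] with q hq
      exact Or.inl hq
    · have : p.2 < ((-(M / δ) : ℝ) : EReal) := hu ▸ EReal.bot_lt_coe _
      filter_upwards [continuousAt_snd.eventually (gt_mem_nhds this)] with q hq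
      exact Or.inr hq
  filter_upwards [hlarge, hc.eventually (gt_mem_nhds (lt_add_one _))] with q hq1 hq2 hq
  simp only [IsInfiniteParam, not_or] at hq
  rw [← EReal.coe_toReal hq.1 hq.2.1, EReal.coe_lt_coe_iff, EReal.coe_lt_coe_iff] at hq1
  have hlt : M / δ < ‖complexCoord L C b γ 0 q‖ := by
    refine lt_of_lt_of_le ?_ (Complex.abs_im_le_norm _)
    rw [complexCoord_im, lt_abs]
    exact hq1.imp_right fun h => by linarith
  refine ⟨norm_pos_iff.1 (lt_trans (by positivity) hlt), hq2.trans ?_⟩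
  rwa [div_lt_iff₀' hδ] at hlt

/-- Normalisation by the form at infinity breaks down here, so `L 0` is used instead: the defect
divided by `s_0` extends continuously by 0. As `|s_0| ≤ |z_0|` for every `u`, the estimate is
uniform in `u`. -/
theorem defectSmallAt_of_atInfinity (hγ : Continuous γ) {hb : b ≠ 0}
    (hs : formSlope L C b 0 ≠ 0) {p : AddCircle (1 : ℝ) × EReal}
    (hp : γ p.1 = directionPoint C hb) : DefectSmallAt L C b γ p := by
  intro δ hδ
  have hγ' : Continuous fun q : AddCircle (1 : ℝ) × EReal => γ q.1 := hγ.comp continuous_fst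
  obtain ⟨c, hc, hrep⟩ := exists_rep_eq_smul_directionVec hp
  have h0 : L 0 ⬝ᵥ (γ p.1).rep ≠ 0 := by
    rw [hrep, dotProduct_smul]
    exact mul_ne_zero hc hs
  have hcont : ContinuousAt (fun q : AddCircle (1 : ℝ) × EReal =>
      ‖toC (formSlope L C b 0 • normRep (L 0) (γ q.1) - directionVec C b)‖) p := by
    have h2 : ContinuousAt (fun q : AddCircle (1 : ℝ) × EReal => normRep (L 0) (γ q.1)) p :=
      ContinuousAt.comp (f := fun q : AddCircle (1 : ℝ) × EReal => γ q.1)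
        (continuousAt_normRep h0) hγ'.continuousAt
    have h3 : ContinuousAt (fun q : AddCircle (1 : ℝ) × EReal =>
        formSlope L C b 0 • normRep (L 0) (γ q.1) - directionVec C b) p :=
      by fun_prop
    exact (continuous_toC.continuousAt.comp h3).norm
  have hzero : ‖toC (formSlope L C b 0 • normRep (L 0) (γ p.1) - directionVec C b)‖ < δ := by
    have h1 : formSlope L C b 0 • normRep (L 0) (γ p.1) - directionVec C b = 0 := by
      rw [normRep, hrep, dotProduct_smul, ← formSlope, smul_smul, smul_smul, smul_eq_mul,
        show formSlope L C b 0 * (c * formSlope L C b 0)⁻¹ * c = 1 by field_simp, one_smul,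
        sub_self]
    rw [h1, show toC (0 : Fin 3 → ℝ) = 0 by funext k; simp [toC], norm_zero]
    exact hδ
  have hne : ∀ᶠ q in 𝓝 p, L 0 ⬝ᵥ (γ q.1).rep ≠ 0 :=
    ((isOpen_dotProduct_rep_ne_zero (L 0)).preimage hγ').mem_nhds h0
  filter_upwards [hne, hcont.eventually (gt_mem_nhds hzero)] with q hq1 hq2 hq
  have hm : infinityRow C ⬝ᵥ (γ q.1).rep ≠ 0 := fun h => hq (Or.inr (Or.inr h))
  have hcoord : slopeCoord L C b 0 (γ q.1) ≠ 0 := by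
    rw [slopeCoord, dotProduct_normRep]
    exact div_ne_zero (div_ne_zero hq1 hm) hs
  have hle : |slopeCoord L C b 0 (γ q.1)| ≤ ‖complexCoord L C b γ 0 q‖ := by
    rw [← complexCoord_re]
    exact Complex.abs_re_le_norm _
  have hdefect : slopeDefect L C b (γ q.1) = slopeCoord L C b 0 (γ q.1) •
      (formSlope L C b 0 • normRep (L 0) (γ q.1) - directionVec C b) := by
    rw [slopeDefect, smul_sub, slopeCoord, dotProduct_normRep, normRep, normRep, smul_smul,
      smul_smul]
    congr 2
    field_simp
  refine ⟨norm_pos_iff.1 ((abs_pos.2 hcoord).trans_le hle), ?_⟩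
  rw [hdefect, toC_smul, norm_smul, Complex.norm_real, Real.norm_eq_abs, mul_comm δ]
  exact (mul_lt_mul_of_pos_left hq2 (abs_pos.2 hcoord)).trans_le
    (mul_le_mul_of_nonneg_right hle hδ.le)

theorem tendsto_liftScale_smul_liftVec {p : AddCircle (1 : ℝ) × EReal}
    (h : DefectSmallAt L C b γ p) :
    Tendsto (fun q => liftScale L C b γ q • liftVec C b γ q) (𝓝 p)
      (𝓝 (toC (directionVec C b))) := by
  rw [Metric.tendsto_nhds]
  intro δ hδ
  filter_upwards [h δ hδ] with q hq
  by_cases hinf : IsInfiniteParam C γ q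
  · rw [liftScale, if_pos (Or.inl hinf), liftVec, if_pos hinf, one_smul, dist_self]
    exact hδ
  · obtain ⟨h0, h1⟩ := hq hinf
    rw [liftScale, if_neg (by tauto), dist_eq_norm, inv_smul_liftVec_sub hinf h0, norm_smul,
      norm_inv, inv_mul_lt_iff₀ (norm_pos_iff.2 h0), mul_comm]
    exact h1

/-- The squares of the ratios `√z_i / √z_0` are the scaled forms, which tend to 1 with the scaled
vector; the sign of the real part then determines the limits of the ratios. -/
theorem tendsto_liftScale_mul_liftRoot (hs : ∀ i, formSlope L C b i ≠ 0)
    {p : AddCircle (1 : ℝ) × EReal} (h : DefectSmallAt L C b γ p)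
    (hsign : ∀ᶠ q in 𝓝 p, hemisphereSign ε q.2 = hemisphereSign ε p.2) :
    Tendsto (fun q => liftScale L C b γ q ^ 3 * liftRoot L C b γ κ ε q) (𝓝 p)
      (𝓝 (κ * hemisphereSign ε p.2)) := by
  classical
  set r : Fin 6 → AddCircle (1 : ℝ) × EReal → ℂ := fun i q => if IsInfiniteParam C γ q then 1 else
    halfSqrt (complexCoord L C b γ i q) / halfSqrt (complexCoord L C b γ 0 q) with hr
  have hne : ∀ᶠ q in 𝓝 p, ¬ IsInfiniteParam C γ q → complexCoord L C b γ 0 q ≠ 0 := by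
    filter_upwards [h 1 one_pos] with q hq hq'
    exact (hq hq').1
  have hrlim (i : Fin 6) : Tendsto (r i) (𝓝 p) (𝓝 1) := by
    have hs' : (formSlope L C b i : ℂ) ≠ 0 := Complex.ofReal_ne_zero.2 (hs i)
    have hlim : Tendsto (fun q => complexForm (L i) (liftScale L C b γ q • liftVec C b γ q) /
        formSlope L C b i) (𝓝 p) (𝓝 1) := by
      have h1 := (((continuous_complexForm (L i)).tendsto _).comp
        (tendsto_liftScale_smul_liftVec h)).div_const (formSlope L C b i : ℂ)
      rwa [complexForm_directionVec, div_self hs'] at h1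
    rw [tendsto_iff_norm_sub_tendsto_zero] at hlim ⊢
    refine squeeze_zero' (Eventually.of_forall fun q => norm_nonneg _) ?_ hlim
    filter_upwards [hne] with q hq
    by_cases hinf : IsInfiniteParam C γ q
    · simp only [hr, if_pos hinf, sub_self, norm_zero]
      exact norm_nonneg _
    · have h0 := hq hinf
      have h2 : r i q ^ 2 = complexForm (L i) (liftScale L C b γ q • liftVec C b γ q) /
          formSlope L C b i := by
        rw [complexForm_smul, complexForm_liftVec_of_not (hs i) hinf, liftScale,
          if_neg (by tauto)]
        simp only [hr, if_neg hinf, div_pow, halfSqrt_sq]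
        field_simp
      rw [← h2]
      refine norm_sub_one_le_of_re_nonneg ?_
      simp only [hr, if_neg hinf]
      exact re_halfSqrt_div_nonneg (by rw [complexCoord_im, complexCoord_im])
  have hprod : Tendsto (fun q => κ * hemisphereSign ε p.2 * ∏ i, r i q) (𝓝 p)
      (𝓝 (κ * hemisphereSign ε p.2)) := by
    simpa using (tendsto_finsetProd Finset.univ fun i _ => hrlim i).const_mul
      (κ * hemisphereSign ε p.2)
  refine hprod.congr' ?_
  filter_upwards [hne, hsign] with q hq hq'
  by_cases hinf : IsInfiniteParam C γ q
  · simp only [hr, if_pos hinf, liftScale, if_pos (Or.inl hinf), liftRoot, hq',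
      Finset.prod_const_one, one_pow, one_mul, mul_one]
  · have h0 := hq hinf
    -- The weight 3 of `w` supplies one factor `√z_0` for each of the six roots.
    have h3 : (complexCoord L C b γ 0 q) ^ 3 = halfSqrt (complexCoord L C b γ 0 q) ^ 6 := by
      rw [← congrArg (· ^ 3) (halfSqrt_sq (complexCoord L C b γ 0 q))]
      ring
    rw [liftScale, if_neg (by tauto), liftRoot, if_neg hinf, hq', inv_pow, h3]
    simp only [hr, if_neg hinf, Finset.prod_div_distrib, Finset.prod_const, Finset.card_univ,
      Fintype.card_fin]
    ring

/-- The sign can jump only at `u = 0`, and only if `ε = -1`. -/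
theorem eventually_hemisphereSign_eq {u : EReal} (h : u ≠ 0 ∨ ε = 1) :
    ∀ᶠ v in 𝓝 u, hemisphereSign ε v = hemisphereSign ε u := by
  rcases h with h | rfl
  · rcases h.lt_or_gt with h | h
    · filter_upwards [gt_mem_nhds h] with v hv
      rw [hemisphereSign, hemisphereSign, if_neg (not_le.2 hv), if_neg (not_le.2 h)]
    · filter_upwards [lt_mem_nhds h] with v hv
      rw [hemisphereSign, hemisphereSign, if_pos hv.le, if_pos h.le]
  · exact Eventually.of_forall fun v => by simp [hemisphereSign]

/-! ### The lift on the suspension -/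

/-- The point of the cone over the lift of the spheroid. -/
def liftCone (hs : ∀ i, formSlope L C b i ≠ 0) (hκ : κ ^ 2 = ∏ i, (formSlope L C b i : ℂ))
    (hε : ε = 1 ∨ ε = -1) (hb : b ≠ 0) (γ : AddCircle (1 : ℝ) → RP2)
    (p : AddCircle (1 : ℝ) × EReal) : DoubleCoverCone L :=
  ⟨(liftVec C b γ p, liftRoot L C b γ κ ε p), liftVec_ne_zero hb p, liftRoot_sq hs hκ hε p⟩

theorem continuous_liftCone_mk (hs : ∀ i, formSlope L C b i ≠ 0)
    (hκ : κ ^ 2 = ∏ i, (formSlope L C b i : ℂ)) (hε : ε = 1 ∨ ε = -1) (hb : b ≠ 0)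
    (hγ : Continuous γ) (hinf : ∀ t, AtInfinity C (γ t) → γ t = directionPoint C hb)
    (hsign : ∀ t, 0 ≤ ε * ∏ i, slopeCoord L C b i (γ t))
    (hεinf : ∀ t, AtInfinity C (γ t) → ε = 1) :
    Continuous fun p =>
      (Quotient.mk (doubleCoverSetoid L) (liftCone hs hκ hε hb γ p) : DoubleCover L) := by
  rw [continuous_iff_continuousAt]
  intro p
  by_cases hp : IsInfiniteParam C γ p
  · have hd : DefectSmallAt L C b γ p := by
      by_cases h : AtInfinity C (γ p.1)
      · exact defectSmallAt_of_atInfinity hγ (hs 0) (hinf _ h)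
      · exact defectSmallAt_of_eq_top_or_bot hγ h (by unfold IsInfiniteParam at hp; tauto)
    have hu : p.2 ≠ 0 ∨ ε = 1 := by
      rcases hp with h | h | h
      · exact Or.inl (by rw [h]; exact EReal.top_ne_zero)
      · exact Or.inl (by rw [h]; exact EReal.bot_ne_zero)
      · exact Or.inr (hεinf _ h)
    have hev : ∀ᶠ q in 𝓝 p, hemisphereSign ε q.2 = hemisphereSign ε p.2 :=
      continuousAt_snd.eventually (eventually_hemisphereSign_eq hu)
    refine continuousAt_doubleCover_mk _ (liftScale L C b γ) liftScale_ne_zero ?_ ?_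
    · exact continuousAt_of_tendsto_nhds (tendsto_liftScale_smul_liftVec hd)
    · exact continuousAt_of_tendsto_nhds (tendsto_liftScale_mul_liftRoot hs hd hev)
  · refine continuousAt_doubleCover_mk _ (fun _ => 1) (fun _ => one_ne_zero) ?_ ?_
    · simpa only [one_smul, liftCone] using continuousAt_liftVec hγ hp
    · simpa only [one_pow, one_mul, liftCone] using continuousAt_liftRoot hγ hε hsign hp

theorem liftVec_mk (hb : b ≠ 0) (hinf : ∀ t, AtInfinity C (γ t) → γ t = directionPoint C hb)
    (p : AddCircle (1 : ℝ) × EReal) :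
    Projectivization.mk ℂ (liftVec C b γ p) (liftVec_ne_zero hb p) = spheroidFun C hb γ p := by
  unfold spheroidFun
  by_cases hu : p.2 = ⊤ ∨ p.2 = ⊥
  · rw [if_pos hu, Projectivization.mk_eq_mk_iff']
    refine ⟨1, ?_⟩
    rw [one_smul, liftVec, if_pos (by unfold IsInfiniteParam; tauto)]
  · rw [if_neg hu, Projectivization.mk_eq_mk_iff']
    by_cases h : AtInfinity C (γ p.1)
    · obtain ⟨c, hc, hrep⟩ := exists_rep_eq_smul_directionVec (hinf _ h)
      -- The imaginary part drops out because the form at infinity vanishes on the direction vector.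
      refine ⟨((c⁻¹ : ℝ) : ℂ), ?_⟩
      rw [liftVec, if_pos (show IsInfiniteParam C γ p from Or.inr (Or.inr h)), ← spheroidVec_smul, hrep, smul_smul,
        inv_mul_cancel₀ hc, one_smul, spheroidVec, infinityForm_directionVec]
      simp
    · refine ⟨(((infinityRow C ⬝ᵥ (γ p.1).rep)⁻¹ : ℝ) : ℂ), ?_⟩
      rw [liftVec, if_neg (by unfold IsInfiniteParam; tauto), ← spheroidVec_smul, normRep]

/-- At `u = ±∞` the vector is constant and the root depends on `t` in no way, only on the
hemisphere. -/
theorem liftCone_congr (hs : ∀ i, formSlope L C b i ≠ 0)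
    (hκ : κ ^ 2 = ∏ i, (formSlope L C b i : ℂ)) (hε : ε = 1 ∨ ε = -1) (hb : b ≠ 0)
    (γ : AddCircle (1 : ℝ) → RP2) {p q : AddCircle (1 : ℝ) × EReal}
    (h : suspensionSetoid.r p q) : liftCone hs hκ hε hb γ p = liftCone hs hκ hε hb γ q := by
  obtain ⟨h1, h2 | h2⟩ := h
  · rw [Prod.ext h2 h1]
  · have hp : IsInfiniteParam C γ p := by unfold IsInfiniteParam; tauto
    have hq : IsInfiniteParam C γ q := by
      rw [h1] at h2
      unfold IsInfiniteParam
      tauto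
    apply Subtype.ext
    simp only [liftCone, liftVec, liftRoot, if_pos hp, if_pos hq, h1]

end

theorem mainTheorem4
    (L : Fin 6 → Fin 3 → ℝ) (hL : NoThreeConcurrent L)
    (C : GL (Fin 3) ℝ) (hC : ∀ i, ChartMeets C (L i))
    (b : Fin 2 → ℝ) (hb : b ∉ exceptionalSet C L)
    (γ : AddCircle (1 : ℝ) → RP2) (hγ : IsAdmissibleCurve L γ)
    (hinf : ∀ t, AtInfinity C (γ t) →
      γ t = directionPoint C (ne_zero_of_notMem_exceptionalSet hb)) :
    Continuous (spheroid C (ne_zero_of_notMem_exceptionalSet hb) γ) ∧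
      ∃ α : Sphere2 → DoubleCover L, Continuous α ∧
        ∀ x, coverMap L (α x) = spheroid C (ne_zero_of_notMem_exceptionalSet hb) γ x := by
  have hb0 := ne_zero_of_notMem_exceptionalSet hb
  have hs := formSlope_ne_zero hL hC hb
  obtain ⟨ε, hε, hsign, hεinf⟩ := hγ.exists_slopeCoord_sign hL hs hinf
  obtain ⟨κ, hκ⟩ := IsAlgClosed.exists_pow_nat_eq (∏ i, (formSlope L C b i : ℂ)) two_pos
  let β : Suspension → DoubleCover L := Quotient.lift
    (fun p => (Quotient.mk (doubleCoverSetoid L) (liftCone hs hκ hε hb0 γ p) : DoubleCover L))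
    fun p q h => congrArg _ (liftCone_congr hs hκ hε hb0 γ h)
  have hβ : Continuous β := (continuous_liftCone_mk hs hκ hε hb0 hγ.continuous hinf hsign
    hεinf).quotient_lift _
  have hlift : ∀ x, coverMap L (β x) = suspensionSpheroid C hb0 γ x := by
    rintro ⟨p⟩
    exact liftVec_mk hb0 hinf p
  have hα : Continuous (β ∘ suspensionHomeo.symm) := hβ.comp suspensionHomeo.symm.continuous
  have heq : ∀ x, coverMap L ((β ∘ suspensionHomeo.symm) x) = spheroid C hb0 γ x :=
    fun x => hlift (suspensionHomeo.symm x)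
  refine ⟨?_, _, hα, heq⟩
  -- The continuity of the spheroid is inherited from that of its lift.
  rw [← funext heq]
  exact (continuous_coverMap L).comp hα
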